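/- Let $\mathbb T$ be a real Hilbert space with a bounded operator $\Omega$ such that $\Omega^*=-\Omega$, $\Omega^2=-I$, and put $\omega(x,y)=\langle x,\Omega y\rangle$. A subspace is Lagrangian if it is a maximal $\omega$-isotropic subspace, and $\operatorname{Sp}(\mathbb T,\omega)$ is the group of bounded automorphisms $g$ with $g^*\Omega g=\Omega$. For complementary closed subspaces $\mathbb A,\mathbb B$ let $[\mathbb{AB}]$ be the operator equal to $+1$ on $\mathbb A$ and $-1$ on $\mathbb B$. Let $\mathbb U\subset\mathbb R$ be an open interval. A curve $\mathbb H$ of Lagrangian subspaces on $\mathbb U$ is *regular* if $\mathbb H(s),\mathbb H(t)$ are complementary for $s\ne t$, if $u\mapsto[\mathbb H(u)\mathbb H(u)^\perp]$ is $C^\infty$ in operator norm, and if for every $u$ there is a bounded operator $\mathbb H_\prime(u)$ (the tangent covector) with $[\mathbb H(u+h)\mathbb H(u)]=2h^{-1}\mathbb H_\prime(u)+o(h^{-1})$ in operator norm as $h\to0$. It is *positive* if moreover $\omega(\mathbb H_\prime(u)x,x)\ge 0$ for all $u\in\mathbb U$, $x\in\mathbb T$. A *positive hyperbolic structure* is a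 pair $(J,K)$ of bounded operators on $\mathbb T$ with $J^*\Omega J=\Omega$, $K^*\Omega K=-\Omega$, $J^2=-I$, $K^2=I$, $JK+KJ=0$, and $\omega(Jx,x)>0$ for $x\neq0$. Let $\mathbb K_\pm=\ker(I\mp K)$, and give $\mathbb K_+$ the inner product $\omega(Jx,y)$; adjoints ${}^*$ of operators on $\mathbb K_+$ and the orthogonal group $O(\mathbb K_+)$ (isometries of $\mathbb K_+$ onto itself) refer to it. Write operators on $\mathbb T$ as $2\times2$ block matrices of operators on $\mathbb K_+$ by means of the isomorphism $\mathbb K_+\oplus\mathbb K_+\to\mathbb T$, $(k,l)\mapsto k+Jl$. **Theorem.** Let $\mathbb H$ be a positive regular curve of Lagrangian subspaces on $\mathbb U$ and $(J,K)$ a positive hyperbolic structure such that every $\mathbb H(u)$, $u\in\mathbb U$, is complementary to $\mathbb K_+$ and to $\mathbb K_-$. Then $\mathbb H(u)=\{H(u)k+Jk : k\in\mathbb K_+\}$ for a smooth curve $H$ of self-adjoint operators on $\mathbb K_+$ whose derivative $\dot H(u)$ is invertible and positive definite for every $u\in\mathbb U$. There is a curve $X$ of invertible operators on $\mathbb K_+$,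 defined on all of $\mathbb U$, with $$\dot X=-\tfrac12\dot H^{-1}\ddot H X,\qquad XX^*=\dot H^{-1}.$$ For every such $X$, put $Y=HX$ and $$M=\begin{bmatrix}\dot Y&Y\\ \dot X&X\end{bmatrix}.$$ Then: 1. $M$ is a smooth curve in $\operatorname{Sp}(\mathbb T,\omega)$, $\mathbb K_-$ is Lagrangian, and $M(u)^{-1}\mathbb H(u)=\mathbb K_-$ for all $u\in\mathbb U$ (so $M$ is a lift of $\mathbb H$). 2. The Maurer–Cartan form pulled back along $M$ is $\Theta\,du$ with $$\Theta=M^{-1}\dot M=\begin{bmatrix}0&I\\-\tfrac12\mathcal S&0\end{bmatrix},\qquad \mathcal S=\tfrac12X^*\bigl(2\dddot H-3\ddot H\dot H^{-1}\ddot H\bigr)X,$$ and $\mathcal S(u)$ (the Lagrange–Schwarzian) is self-adjoint. 3. The freedom in the construction is exactly $X\mapsto XR$, $M\mapsto M\begin{bmatrix}R&0\\0&R\end{bmatrix}$ with a constant $R\in O(\mathbb K_+)$. Moreover every smooth curve $N$ in $\operatorname{Sp}(\mathbb T,\omega)$ with $N(u)^{-1}\mathbb H(u)=\mathbb K_-$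 for all $u\in\mathbb U$, whose Maurer–Cartan form $N^{-1}\dot N$ has the shape $\begin{bmatrix}0&I\\ C(u)&0\end{bmatrix}$, equals $M\begin{bmatrix}R&0\\0&R\end{bmatrix}$ for some constant $R\in O(\mathbb K_+)$. -/

import Mathlib

open scoped ContDiff Topology

noncomputable section

namespace LagrangeLift

variable {T : Type*} [NormedAddCommGroup T] [InnerProductSpace ℝ T] [CompleteSpace T]

/-! ### Reflections and curves of subspaces -/

open Classical in
/-- The reflection `[A B]` of a pair of complementary subspaces: the bounded operator which is
`+1` on `A` and `-1` on `B` (and `0` if `A` and `B` are not complementary). -/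
def reflection (A B : Submodule ℝ T) : T →L[ℝ] T :=
  if h : A.IsTopCompl B then A.projectionL B h - B.projectionL A h.symm else 0

/-- `L` is the tangent covector at `u` of the curve `H` of subspaces:
`[H(u+h) H(u)] = 2 h⁻¹ L + o(h⁻¹)` in operator norm as `h → 0`. -/
def HasTangentCovector (H : ℝ → Submodule ℝ T) (u : ℝ) (L : T →L[ℝ] T) : Prop :=
  (fun h : ℝ => reflection (H (u + h)) (H u) - (2 * h⁻¹) • L) =o[𝓝[≠] 0] fun h : ℝ => h⁻¹

/-- A regular curve of closed subspaces on `U`: nondegenerate, codifferentiable and smooth, where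
smoothness is that of the reflections `[H(u) H(u)ᗮ]` in operator norm. -/
structure IsRegularCurve (U : Set ℝ) (H : ℝ → Submodule ℝ T) : Prop where
  isClosed : ∀ u ∈ U, IsClosed (H u : Set T)
  nondegenerate : ∀ s ∈ U, ∀ t ∈ U, s ≠ t → (H s).IsTopCompl (H t)
  codifferentiable : ∀ u ∈ U, ∃ L : T →L[ℝ] T, HasTangentCovector H u L
  smooth : ContDiffOn ℝ ∞ (fun u => reflection (H u) (H u)ᗮ) U

/-! ### Hilbert symplectic spaces -/

variable (T) in
/-- A Hermitian symplectic structure on a real Hilbert space. -/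
structure SymplecticStructure where
  /-- the operator `Ω` with `Ω* = -Ω` and `Ω² = -1` -/
  Om : T →L[ℝ] T
  adjoint_eq : ContinuousLinearMap.adjoint Om = -Om
  sq_eq : Om ∘L Om = -ContinuousLinearMap.id ℝ T

namespace SymplecticStructure

variable (S : SymplecticStructure T)

/-- The symplectic form `ω(x, y) = ⟨x, Ω y⟩`. -/
def form (x y : T) : ℝ := inner ℝ x (S.Om y)

/-- Isotropic subspaces. -/
def IsIsotropic (X : Submodule ℝ T) : Prop := ∀ x ∈ X, ∀ y ∈ X, S.form x y = 0

/-- Lagrangian subspaces: the maximal isotropic ones. -/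
def IsLagrangian (X : Submodule ℝ T) : Prop := Maximal S.IsIsotropic X

/-- Membership in the symplectic group. -/
def IsCanonical (g : T →L[ℝ] T) : Prop :=
  Function.Bijective g ∧ ContinuousLinearMap.adjoint g ∘L S.Om ∘L g = S.Om

/-- A regular curve in the Lagrangian Grassmannian is positive if the quadratic form
`x ↦ ω(L x, x)` of each of its tangent covectors `L` is positive semidefinite. -/
def IsPositiveRegularCurve (U : Set ℝ) (H : ℝ → Submodule ℝ T) : Prop :=
  IsRegularCurve U H ∧ (∀ u ∈ U, S.IsLagrangian (H u)) ∧
    ∀ u ∈ U, ∃ L : T →L[ℝ] T, HasTangentCovector H u L ∧ ∀ x, 0 ≤ S.form (L x) x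

/-- `M` is a lift of the curve `H` to the symplectic group, with
`M(u)⁻¹ H(u)` equal to the fixed Lagrangian subspace `B` for all `u`. -/
structure IsLift (U : Set ℝ) (H : ℝ → Submodule ℝ T) (B : Submodule ℝ T)
    (M : ℝ → T →L[ℝ] T) : Prop where
  smooth : ContDiffOn ℝ ∞ M U
  canonical : ∀ u ∈ U, S.IsCanonical (M u)
  lagrangian : S.IsLagrangian B
  comap_eq : ∀ u ∈ U, (H u).comap (M u : T →ₗ[ℝ] T) = B

end SymplecticStructure

/-- The pullback `M⁻¹ Ṁ` (coefficient of `du`) of the Maurer–Cartan form along the curve `M`. -/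
def maurerCartan (M : ℝ → T →L[ℝ] T) (u : ℝ) : T →L[ℝ] T := Ring.inverse (M u) * deriv M u

/-! ### Positive hyperbolic structures -/

/-- A positive hyperbolic structure `(J, K)`: `J` is symplectic, `K` is antisymplectic, `J² = -1`,
`K² = 1`, `J K + K J = 0`, and `ω(J x, y)` is positive definite. -/
structure HyperbolicStructure (S : SymplecticStructure T) where
  /-- the complex structure -/
  J : T →L[ℝ] T
  /-- the reflection -/
  K : T →L[ℝ] T
  canonical : ContinuousLinearMap.adjoint J ∘L S.Om ∘L J = S.Om
  anticanonical : ContinuousLinearMap.adjoint K ∘L S.Om ∘L K = -S.Om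
  J_sq : ∀ x, J (J x) = -x
  K_sq : ∀ x, K (K x) = x
  anticomm : ∀ x, J (K x) + K (J x) = 0
  positive : ∀ x, x ≠ 0 → 0 < S.form (J x) x

namespace HyperbolicStructure

variable {S : SymplecticStructure T} (P : HyperbolicStructure S)

/-- The subspace `K₊ = ker (1 - K)`. -/
def plus : Submodule ℝ T :=
  LinearMap.ker ((ContinuousLinearMap.id ℝ T - P.K : T →L[ℝ] T) : T →ₗ[ℝ] T)

/-- The subspace `K₋ = ker (1 + K)`. -/
def minus : Submodule ℝ T :=
  LinearMap.ker ((ContinuousLinearMap.id ℝ T + P.K : T →L[ℝ] T) : T →ₗ[ℝ] T)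

theorem mem_plus {x : T} : x ∈ P.plus ↔ P.K x = x := by
  have h : x ∈ P.plus ↔ x - P.K x = 0 := Iff.rfl
  rw [h, sub_eq_zero, eq_comm]

theorem mem_minus {x : T} : x ∈ P.minus ↔ P.K x = -x := by
  have h : x ∈ P.minus ↔ x + P.K x = 0 := Iff.rfl
  rw [h, add_comm, add_eq_zero_iff_eq_neg]

theorem K_J (x : T) : P.K (P.J x) = -P.J (P.K x) :=
  (neg_eq_of_add_eq_zero_right (P.anticomm x)).symm

/-- The positive definite inner product `ω(J x, y)`. -/
def g (x y : T) : ℝ := S.form (P.J x) y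

/-- The component of `x` in `K₊`. -/
def fst : T →L[ℝ] P.plus :=
  ((1 / 2 : ℝ) • (ContinuousLinearMap.id ℝ T + P.K)).codRestrict P.plus (by
    intro x
    rw [mem_plus]
    simp [P.K_sq, add_comm])

/-- The component of `x` in `K₋`, transported to `K₊` by `J⁻¹ = -J`. -/
def snd : T →L[ℝ] P.plus :=
  (-(P.J ∘L ((1 / 2 : ℝ) • (ContinuousLinearMap.id ℝ T - P.K)))).codRestrict P.plus (by
    intro x
    rw [mem_plus]
    simp [P.K_J, P.K_sq, sub_eq_neg_add, add_comm])

theorem coe_fst (x : T) : (P.fst x : T) = (1 / 2 : ℝ) • (x + P.K x) := rfl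

theorem coe_snd (x : T) : (P.snd x : T) = -P.J ((1 / 2 : ℝ) • (x - P.K x)) := rfl

/-- The identification `T ≃ K₊ ⊕ K₊` given by the hyperbolic structure: it is the identity on `K₊`
and `J⁻¹` on `K₋`, so its inverse is `(k, l) ↦ k + J l`. -/
def split : T ≃L[ℝ] P.plus × P.plus :=
  ContinuousLinearEquiv.equivOfInverse (P.fst.prod P.snd)
    ((P.plus.subtypeL).coprod (P.J ∘L P.plus.subtypeL))
    (by
      intro x
      simp only [ContinuousLinearMap.prod_apply, ContinuousLinearMap.coprod_apply,
        Submodule.subtypeL_apply, ContinuousLinearMap.comp_apply, coe_fst, coe_snd, map_neg,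
        P.J_sq]
      module)
    (by
      rintro ⟨k, l⟩
      have hk := P.mem_plus.1 k.2
      have hl := P.mem_plus.1 l.2
      ext
      · simp [coe_fst, P.K_J, hk, hl]
        module
      · simp [coe_snd, P.K_J, hk, hl, P.J_sq]
        module)

theorem split_symm_apply (k l : P.plus) : P.split.symm (k, l) = (k : T) + P.J l := rfl

/-- The operator on `T` with the block matrix `[[A, B], [C, D]]` in the splitting
`T = K₊ ⊕ K₋ ≃ K₊ ⊕ K₊`. -/
def block (A B C D : P.plus →L[ℝ] P.plus) : T →L[ℝ] T :=
  (P.split.symm : P.plus × P.plus →L[ℝ] T) ∘L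
    ((A.coprod B).prod (C.coprod D)) ∘L (P.split : T →L[ℝ] P.plus × P.plus)

theorem g_eq (x y : T) : P.g x y = inner ℝ x (-(S.Om (P.J y))) := by
  have h := congrArg (fun F : T →L[ℝ] T => F (P.J y)) P.canonical
  simp only [ContinuousLinearMap.comp_apply, P.J_sq, map_neg] at h
  rw [← h, neg_neg, ContinuousLinearMap.adjoint_inner_right]
  rfl

theorem g_comm (x y : T) : P.g x y = P.g y x := by
  rw [g_eq, g, SymplecticStructure.form, ← ContinuousLinearMap.adjoint_inner_left, S.adjoint_eq,
    neg_apply, real_inner_comm]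

theorem g_self_pos {x : T} (hx : x ≠ 0) : 0 < P.g x x := P.positive x hx

theorem g_K_K (x y : T) : P.g (P.K x) (P.K y) = P.g x y := by
  have h := congrArg (fun F : T →L[ℝ] T => inner ℝ (P.J x) (F y)) P.anticanonical
  simp only [ContinuousLinearMap.comp_apply, ContinuousLinearMap.adjoint_inner_right, P.K_J,
    inner_neg_left, neg_apply, inner_neg_right, neg_inj] at h
  exact h

/-- Every bounded operator on `K₊` has an adjoint for the inner product `ω(J x, y)`. -/
theorem exists_adj (X : P.plus →L[ℝ] P.plus) :
    ∃ Y : P.plus →L[ℝ] P.plus, ∀ k l : P.plus, P.g (X k) l = P.g k (Y l) := by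
  let X' : T →L[ℝ] T := P.plus.subtypeL ∘L X ∘L P.fst
  let G : T →L[ℝ] T := -(S.Om ∘L P.J)
  let Z : T →L[ℝ] T := -(P.J ∘L S.Om)
  have hO : ∀ x, S.Om (S.Om x) = -x := fun x =>
    congrArg (fun F : T →L[ℝ] T => F x) S.sq_eq
  have hGZ : ∀ x, G (Z x) = x := by
    intro x
    simp [G, Z, P.J_sq, hO]
  have hg : ∀ x y, P.g x y = inner ℝ x (G y) := fun x y => P.g_eq x y
  have hfst : ∀ k : P.plus, P.fst (k : T) = k := by
    intro k
    have hk := P.mem_plus.1 k.2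
    ext
    rw [coe_fst, hk]
    module
  have hproj : ∀ (k : P.plus) (y : T), P.g k (P.fst y : T) = P.g k y := by
    intro k y
    have h1 := P.g_K_K k y
    rw [P.mem_plus.1 k.2] at h1
    rw [coe_fst, hg, map_smul, map_add, inner_smul_right, inner_add_right, ← hg, ← hg, h1]
    ring
  refine ⟨P.fst ∘L Z ∘L ContinuousLinearMap.adjoint X' ∘L G ∘L P.plus.subtypeL, ?_⟩
  intro k l
  simp only [ContinuousLinearMap.comp_apply, Submodule.subtypeL_apply]
  rw [hproj, hg, hg, hGZ, ContinuousLinearMap.adjoint_inner_right]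
  simp [X', hfst]

/-- The adjoint `X*` of an operator on `K₊` for the inner product `ω(J x, y)`. -/
def adj (X : P.plus →L[ℝ] P.plus) : P.plus →L[ℝ] P.plus := Classical.choose (P.exists_adj X)

theorem g_adj (X : P.plus →L[ℝ] P.plus) (k l : P.plus) : P.g (X k) l = P.g k (P.adj X l) :=
  Classical.choose_spec (P.exists_adj X) k l

/-- The adjoint is unique. -/
theorem eq_adj (X Y : P.plus →L[ℝ] P.plus)
    (h : ∀ k l : P.plus, P.g (X k) l = P.g k (Y l)) : Y = P.adj X := by
  ext l
  by_contra hne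
  have hne' : ((Y l : T) - (P.adj X l : T)) ≠ 0 := sub_ne_zero.2 hne
  have h1 := P.g_self_pos hne'
  have h2 : P.g ((Y l - P.adj X l : P.plus) : T) ((Y l : T) - (P.adj X l : T)) = 0 := by
    rw [g_eq, map_sub, map_sub, neg_sub', inner_sub_right, ← g_eq, ← g_eq, ← h, ← g_adj, sub_self]
  rw [Submodule.coe_sub] at h2
  linarith

/-- The orthogonal group `O(K₊)` of `K₊` with the inner product `ω(J x, y)`. -/
def IsOrthogonal (R : P.plus →L[ℝ] P.plus) : Prop :=
  Function.Surjective R ∧ ∀ k l : P.plus, P.g (R k) (R l) = P.g k l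

/-- The subspace `im [H; 1] = {H k + J k : k ∈ K₊}`. -/
def graph (H : P.plus →L[ℝ] P.plus) : Submodule ℝ T :=
  LinearMap.range (((P.plus.subtypeL ∘L H) + P.J ∘L P.plus.subtypeL : P.plus →L[ℝ] T) :
    P.plus →ₗ[ℝ] T)

/-- `X(u)` is invertible, `Ẋ = -½ Ḣ⁻¹ Ḧ X` and `X X* = Ḣ⁻¹` on `U`. -/
structure IsFrame (U : Set ℝ) (H X : ℝ → P.plus →L[ℝ] P.plus) : Prop where
  isUnit : ∀ u ∈ U, IsUnit (X u)
  hasDerivAt : ∀ u ∈ U, HasDerivAt X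
    (-(1 / 2 : ℝ) • (Ring.inverse (deriv H u) * iteratedDeriv 2 H u * X u)) u
  mul_adj : ∀ u ∈ U, X u * P.adj (X u) = Ring.inverse (deriv H u)

/-- The curve `M = [[Ẏ, Y], [Ẋ, X]]` with `Y = H X`. -/
def lift (H X : ℝ → P.plus →L[ℝ] P.plus) (u : ℝ) : T →L[ℝ] T :=
  P.block (deriv (fun t => H t * X t) u) (H u * X u) (deriv X u) (X u)

/-- The Lagrange–Schwarzian `½ X* (2 H''' - 3 H'' H'⁻¹ H'') X`. -/
def schwarzian (H X : ℝ → P.plus →L[ℝ] P.plus) (u : ℝ) : P.plus →L[ℝ] P.plus :=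
  (1 / 2 : ℝ) • (P.adj (X u) *
    ((2 : ℝ) • iteratedDeriv 3 H u -
      (3 : ℝ) • (iteratedDeriv 2 H u * Ring.inverse (deriv H u) * iteratedDeriv 2 H u)) * X u)

end HyperbolicStructure

end LagrangeLift

end

noncomputable section

namespace LagrangeLift

/-! ### Linear differential equations in Banach algebras -/

section BanachAlgebra

/-! A subspace complementary to `K₊` is the graph of an operator `H`, and isotropy makes `H`
self-adjoint. The projection onto one graph along another has the inverse of the difference of the
two operators as its lower left corner (`sub_mul_eq_one_of_isTopCompl`). Multiplying by `h` and
letting `h → 0` shows that a corner of the tangent covector inverts `H'` (`deriv_mul_snd_eq_one`),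
and Cauchy–Schwarz then turns semidefiniteness of that corner into definiteness of `H'`.

The equation for `X` is linear, hence solvable on all of `U` by a Dyson series, and it conserves `X*
H' X`. The normalization `X X* = H'⁻¹` therefore only has to be arranged at one point
(`exists_isUnit_star_mul_mul_eq_one`). No square root is needed there: the same equation, run along
a path from `1` to `H'(u₀)`, produces the initial value. Conservation of `X* H' Z` for two frames
`X`, `Z` gives a constant `R` with `Z = X R`, which is the whole freedom.

Differentiating once more yields `X'' = -½ X S` and `Y'' = -½ Y S`, which is the shape of the
Maurer–Cartan form. Conversely, let a lift have that shape and right column `(b, d)`. Its left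
column is `(b', d')`, and `b = H d`; comparing second derivatives leaves `H'' d + 2 H' d' = 0`, and
the symplectic relation normalizes `d`. So every such lift comes from a frame
(`IsSchwarzFrame.of_hasDerivAt`). All of this calculus takes place in a Banach algebra with a
continuous anti-involution `σ`, later specialized to the adjoint on `K₊`. -/

theorem exists_eq_of_hasDerivAt_zero {E : Type*} [NormedAddCommGroup E] [NormedSpace ℝ E]
    {f : ℝ → E} {U : Set ℝ} (hU : IsOpen U)
    (hU' : U.OrdConnected) (hf : ∀ t ∈ U, HasDerivAt f 0 t) : ∃ c, ∀ t ∈ U, f t = c :=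
  hU.exists_is_const_of_deriv_eq_zero hU'.isPreconnected
    (fun t ht => (hf t ht).differentiableAt.differentiableWithinAt) fun t ht => (hf t ht).deriv

theorem hasDerivAt_integral_of_continuousOn {E : Type*} [NormedAddCommGroup E] [NormedSpace ℝ E]
    [CompleteSpace E] {f : ℝ → E} {U : Set ℝ} (hU : IsOpen U)
    (hU' : U.OrdConnected) (hf : ContinuousOn f U) {t₀ t : ℝ} (ht₀ : t₀ ∈ U) (ht : t ∈ U) :
    HasDerivAt (fun t => ∫ s in t₀..t, f s) (f t) t :=
  intervalIntegral.integral_hasDerivAt_right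
    ((hf.mono (hU'.uIcc_subset ht₀ ht)).intervalIntegrable)
    (hf.stronglyMeasurableAtFilter hU t ht) (hf.continuousAt (hU.mem_nhds ht))

variable {A : Type*} [NormedRing A] [NormedAlgebra ℝ A]

/-- Bootstrapping: if `X` is `C^n`, so is `a X = X'`. -/
theorem contDiffOn_of_hasDerivAt_mul {a X : ℝ → A} {U : Set ℝ} (hU : IsOpen U)
    (ha : ContDiffOn ℝ ∞ a U) (hX : ∀ t ∈ U, HasDerivAt X (a t * X t) t) :
    ContDiffOn ℝ ∞ X U := by
  rw [contDiffOn_infty]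
  intro n
  induction n with
  | zero => exact contDiffOn_zero.2 fun t ht => (hX t ht).continuousAt.continuousWithinAt
  | succ n ih =>
    push_cast
    rw [contDiffOn_succ_iff_deriv_of_isOpen hU]
    refine ⟨fun t ht => (hX t ht).differentiableAt.differentiableWithinAt, by simp, ?_⟩
    exact (((contDiffOn_infty.1 ha) n).mul ih).congr fun t ht => (hX t ht).deriv

/-- The terms of the Dyson series of the equation `X' = a X`. -/
def dysonTerm (a : ℝ → A) (t₀ : ℝ) (X₀ : A) : ℕ → ℝ → A
  | 0 => fun _ => X₀
  | n + 1 => fun t => ∫ s in t₀..t, a s * dysonTerm a t₀ X₀ n s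

/-- Each integration of `|s - t₀| ^ n` contributes a factor `1 / (n + 1)`. The resulting factorial
makes the series converge on intervals of any length, which is what makes existence global. -/
theorem norm_dysonTerm_le {a : ℝ → A} {U : Set ℝ} (hU' : U.OrdConnected)
    {t₀ : ℝ} (ht₀ : t₀ ∈ U) (X₀ : A) {C : ℝ} (hC : ∀ t ∈ U, ‖a t‖ ≤ C) (n : ℕ) :
    ∀ t ∈ U, ‖dysonTerm a t₀ X₀ n t‖ ≤ (C * |t - t₀|) ^ n / n.factorial * ‖X₀‖ := by
  have hC0 : 0 ≤ C := (norm_nonneg _).trans (hC t₀ ht₀)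
  induction n with
  | zero => simp [dysonTerm]
  | succ n ih =>
    intro t ht
    have h1 : ∀ s ∈ Set.uIoc t₀ t, ‖a s * dysonTerm a t₀ X₀ n s‖ ≤
        C ^ (n + 1) / n.factorial * ‖X₀‖ * |s - t₀| ^ n := by
      intro s hs
      have hsU : s ∈ U := hU'.uIcc_subset ht₀ ht (Set.uIoc_subset_uIcc hs)
      refine (norm_mul_le _ _).trans ((mul_le_mul (hC s hsU) (ih s hsU) (norm_nonneg _) hC0).trans
        (le_of_eq ?_))
      rw [mul_pow, pow_succ]
      ring
    have h2 : ‖∫ s in t₀..t, a s * dysonTerm a t₀ X₀ n s‖ ≤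
        |∫ s in t₀..t, C ^ (n + 1) / n.factorial * ‖X₀‖ * |s - t₀| ^ n| :=
      intervalIntegral.norm_integral_le_abs_of_norm_le
        ((MeasureTheory.ae_restrict_mem measurableSet_uIoc).mono fun s hs => h1 s hs)
        (Continuous.intervalIntegrable (by fun_prop) _ _)
    refine h2.trans (le_of_eq ?_)
    rw [intervalIntegral.integral_const_mul, abs_mul, intervalIntegral.abs_intervalIntegral_eq,
      integral_pow_abs_sub_uIoc, abs_of_nonneg (by positivity), abs_of_nonneg (by positivity),
      mul_pow, Nat.factorial_succ]
    push_cast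
    field_simp

theorem map_one_of_anti {σ : A →L[ℝ] A} (hσ : ∀ x y, σ (x * y) = σ y * σ x)
    (hσσ : ∀ x, σ (σ x) = x) : σ 1 = 1 := by
  simpa [hσσ] using (hσ (σ 1) 1).symm

theorem map_ringInverse {σ : A →L[ℝ] A} (hσ : ∀ x y, σ (x * y) = σ y * σ x)
    (hσσ : ∀ x, σ (σ x) = x) {p : A} (hu : IsUnit p) (hp : σ p = p) :
    σ (Ring.inverse p) = Ring.inverse p := by
  have h1 : σ (Ring.inverse p) * p = 1 := by
    nth_rw 2 [← hp]
    rw [← hσ, Ring.mul_inverse_cancel _ hu, map_one_of_anti hσ hσσ]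
  rw [← mul_one (σ _), ← Ring.mul_inverse_cancel _ hu, ← mul_assoc, h1, one_mul]

theorem map_hasDerivAt_of_map_eq {σ : A →L[ℝ] A} {U : Set ℝ} (hU : IsOpen U) {f : ℝ → A} {f' : A}
    (hfσ : ∀ t ∈ U, σ (f t) = f t) {u : ℝ} (hu : u ∈ U) (hf : HasDerivAt f f' u) : σ f' = f' := by
  refine (σ.hasFDerivAt.comp_hasDerivAt u hf).unique (hf.congr_of_eventuallyEq ?_)
  filter_upwards [hU.mem_nhds hu] with s hs using hfσ s hs

variable [CompleteSpace A]

theorem continuousOn_dysonTerm {a : ℝ → A} {U : Set ℝ} (hU : IsOpen U) (hU' : U.OrdConnected)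
    (ha : ContinuousOn a U) {t₀ : ℝ} (ht₀ : t₀ ∈ U) (X₀ : A) (n : ℕ) :
    ContinuousOn (dysonTerm a t₀ X₀ n) U := by
  induction n with
  | zero => exact continuousOn_const
  | succ n ih => exact fun t ht =>
      (hasDerivAt_integral_of_continuousOn hU hU' (ha.mul ih) ht₀
        ht).continuousAt.continuousWithinAt

/-- Linear differential equations are solvable on every open interval on which their coefficient
is continuous. -/
theorem exists_hasDerivAt_mul {a : ℝ → A} {U : Set ℝ} (hU : IsOpen U) (hU' : U.OrdConnected)
    (ha : ContinuousOn a U) {t₀ : ℝ} (ht₀ : t₀ ∈ U) (X₀ : A) :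
    ∃ X : ℝ → A, X t₀ = X₀ ∧ ∀ t ∈ U, HasDerivAt X (a t * X t) t := by
  refine ⟨fun t => ∑' n, dysonTerm a t₀ X₀ n t, ?_, fun t ht => ?_⟩
  · change ∑' n, dysonTerm a t₀ X₀ n t₀ = X₀
    rw [tsum_eq_single 0]
    · rfl
    · rintro (_ | n) hn
      · exact absurd rfl hn
      · simp [dysonTerm]
  -- The coefficient need not be bounded on `U`, so the estimate is made on a compact interval
  -- inside `U` having both `t` and `t₀` in its interior.
  · obtain ⟨c, d, hcd, hsub⟩ : ∃ c d, (t ∈ Set.Ioo c d ∧ t₀ ∈ Set.Ioo c d) ∧ Set.Icc c d ⊆ U := by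
      obtain ⟨ε, hε, hball⟩ := Metric.isOpen_iff.1 hU _ (min_rec' (· ∈ U) ht ht₀)
      obtain ⟨δ, hδ, hball'⟩ := Metric.isOpen_iff.1 hU _ (max_rec' (· ∈ U) ht ht₀)
      have h1 := min_le_left t t₀
      have h2 := min_le_right t t₀
      have h3 := le_max_left t t₀
      have h4 := le_max_right t t₀
      refine ⟨min t t₀ - ε / 2, max t t₀ + δ / 2,
        ⟨⟨by linarith, by linarith⟩, ⟨by linarith, by linarith⟩⟩, hU'.out (hball ?_) (hball' ?_)⟩
      · rw [Metric.mem_ball, Real.dist_eq, abs_lt]; constructor <;> linarith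
      · rw [Metric.mem_ball, Real.dist_eq, abs_lt]; constructor <;> linarith
    obtain ⟨C, hC⟩ := isCompact_Icc.exists_bound_of_continuousOn (ha.mono hsub)
    have hsub' : Set.Ioo c d ⊆ U := Set.Ioo_subset_Icc_self.trans hsub
    have hC0 : 0 ≤ C := (norm_nonneg _).trans (hC t (Set.Ioo_subset_Icc_self hcd.1))
    have hbound : ∀ n, ∀ s ∈ Set.Ioo c d,
        ‖dysonTerm a t₀ X₀ n s‖ ≤ (C * (d - c)) ^ n / n.factorial * ‖X₀‖ := by
      intro n s hs
      refine (norm_dysonTerm_le Set.ordConnected_Ioo hcd.2 X₀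
        (fun s hs => hC s (Set.Ioo_subset_Icc_self hs)) n s hs).trans ?_
      gcongr
      rw [abs_le]
      constructor <;> linarith [hs.1, hs.2, hcd.2.1, hcd.2.2]
    have hsum := (Real.summable_pow_div_factorial (C * (d - c))).mul_right ‖X₀‖
    have hsum' : ∀ s ∈ Set.Ioo c d, Summable fun n => dysonTerm a t₀ X₀ n s := fun s hs =>
      Summable.of_norm_bounded hsum fun n => hbound n s hs
    -- The constant zeroth term is split off: term `n + 1` has derivative `a` times term `n`, so the
    -- differentiated tail is `a` times the full series.
    have key : HasDerivAt (fun t => ∑' n, dysonTerm a t₀ X₀ (n + 1) t)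
        (∑' n, a t * dysonTerm a t₀ X₀ n t) t := by
      refine hasDerivAt_tsum_of_isPreconnected (hsum.mul_left C) isOpen_Ioo isPreconnected_Ioo
        (g := fun n => dysonTerm a t₀ X₀ (n + 1)) (g' := fun n s => a s * dysonTerm a t₀ X₀ n s)
        ?_ ?_ hcd.1 ((summable_nat_add_iff 1).2 (hsum' t hcd.1)) hcd.1
      · exact fun n s hs => hasDerivAt_integral_of_continuousOn hU hU'
          (ha.mul (continuousOn_dysonTerm hU hU' ha ht₀ X₀ n)) ht₀ (hsub' hs)
      · exact fun n s hs => (norm_mul_le _ _).trans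
          (mul_le_mul (hC s (Set.Ioo_subset_Icc_self hs)) (hbound n s hs) (norm_nonneg _) hC0)
    rw [(hsum' t hcd.1).tsum_mul_left] at key
    refine (key.const_add X₀).congr_of_eventuallyEq ?_
    filter_upwards [Ioo_mem_nhds hcd.1.1 hcd.1.2] with s hs
    rw [(hsum' s hs).tsum_eq_zero_add]
    rfl

theorem hasDerivAt_ringInverse {p : ℝ → A} {p' : A} {t : ℝ} (hu : IsUnit (p t))
    (hp : HasDerivAt p p' t) :
    HasDerivAt (fun s => Ring.inverse (p s))
      (-(Ring.inverse (p t) * p' * Ring.inverse (p t))) t := by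
  obtain ⟨v, hv⟩ := hu
  have h := hasFDerivAt_ringInverse (𝕜 := ℝ) v
  rw [hv] at h
  have := h.comp_hasDerivAt t hp
  rw [← hv, Ring.inverse_unit]
  simpa using! this

theorem contDiffOn_ringInverse {p : ℝ → A} {U : Set ℝ} {n : WithTop ℕ∞}
    (hu : ∀ t ∈ U, IsUnit (p t)) (hp : ContDiffOn ℝ n p U) :
    ContDiffOn ℝ n (fun t => Ring.inverse (p t)) U := by
  intro t ht
  obtain ⟨v, hv⟩ := hu t ht
  have h := contDiffAt_ringInverse ℝ (n := n) v
  rw [hv] at h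
  exact h.comp_contDiffWithinAt t (hp t ht)

/-- A solution of `X' = -½ P⁻¹ P' X` with `X* P X = 1` at one point, where `*` is a continuous
anti-involution that fixes `P`, is invertible and satisfies this relation everywhere. -/
theorem isUnit_and_star_mul_mul_eq_one {σ : A →L[ℝ] A} (hσ : ∀ x y, σ (x * y) = σ y * σ x)
    (hσσ : ∀ x, σ (σ x) = x) {U : Set ℝ} (hU : IsOpen U) (hU' : U.OrdConnected)
    {P P' X : ℝ → A} (hP : ∀ t ∈ U, HasDerivAt P (P' t) t) (hPu : ∀ t ∈ U, IsUnit (P t))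
    (hPσ : ∀ t ∈ U, σ (P t) = P t)
    (hX : ∀ t ∈ U, HasDerivAt X (-(1 / 2 : ℝ) • (Ring.inverse (P t) * P' t * X t)) t)
    {t₀ : ℝ} (ht₀ : t₀ ∈ U) (hX₀ : IsUnit (X t₀)) (h₀ : σ (X t₀) * P t₀ * X t₀ = 1) :
    ∀ t ∈ U, IsUnit (X t) ∧ σ (X t) * P t * X t = 1 := by
  have hP'σ : ∀ t ∈ U, σ (P' t) = P' t := fun t ht =>
    map_hasDerivAt_of_map_eq hU hPσ ht (hP t ht)
  have hinvσ : ∀ t ∈ U, σ (Ring.inverse (P t)) = Ring.inverse (P t) := fun t ht =>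
    map_ringInverse hσ hσσ (hPu t ht) (hPσ t ht)
  -- The outer factors each contribute `-½ X* P' X`, cancelling the derivative of the middle one.
  have hder : ∀ t ∈ U, HasDerivAt (fun t => σ (X t) * P t * X t) 0 t := fun t ht => by
    have h1 := σ.hasFDerivAt.comp_hasDerivAt t (hX t ht)
    convert! (h1.mul (hP t ht)).mul (hX t ht) using 1
    simp only [Function.comp_apply, map_smul, hσ, hP'σ t ht, hinvσ t ht, mul_assoc, smul_mul_assoc,
      mul_smul_comm, Ring.inverse_mul_cancel_left _ _ (hPu t ht),
      Ring.mul_inverse_cancel_left _ _ (hPu t ht), add_mul, Pi.mul_apply]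
    module
  obtain ⟨c, hc⟩ := exists_eq_of_hasDerivAt_zero hU hU' hder
  have hone : ∀ t ∈ U, σ (X t) * P t * X t = 1 := fun t ht => by rw [hc t ht, ← hc t₀ ht₀, h₀]
  have hXc : ContinuousOn X U := fun t ht => (hX t ht).continuousAt.continuousWithinAt
  have hPc : ContinuousOn P U := fun t ht => (hP t ht).continuousAt.continuousWithinAt
  have hcont : ContinuousOn (fun t => X t * (σ (X t) * P t)) U :=
    hXc.mul ((σ.continuous.comp_continuousOn hXc).mul hPc)
  have hright : ∀ t ∈ U, IsUnit (X t) → X t * (σ (X t) * P t) = 1 := fun t ht hu => by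
    have h1 := hone t ht
    rw [← mul_one (σ (X t) * P t), ← Ring.mul_inverse_cancel _ hu, ← mul_assoc _ (X t), h1,
      one_mul, Ring.mul_inverse_cancel _ hu]
  have hunit : ∀ t ∈ U, X t * (σ (X t) * P t) = 1 → IsUnit (X t) := fun t ht h =>
    ⟨⟨X t, σ (X t) * P t, h, hone t ht⟩, rfl⟩
  -- So far `X` only has a left inverse. The set where it is a unit is open, and relatively closed
  -- because there the left inverse is also a right inverse, a closed condition; `U` is connected.
  have hopen : IsOpen (U ∩ X ⁻¹' {x | IsUnit x}) := hXc.isOpen_inter_preimage hU Units.isOpen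
  have hsub : U ⊆ U ∩ X ⁻¹' {x | IsUnit x} := by
    refine hU'.isPreconnected.subset_of_closure_inter_subset hopen ⟨t₀, ht₀, ht₀, hX₀⟩ ?_
    rintro t ⟨htc, ht⟩
    refine ⟨ht, hunit t ht ?_⟩
    have hmem : X t * (σ (X t) * P t) ∈ closure {(1 : A)} := by
      refine ((hcont t ht).mono Set.inter_subset_left).mem_closure htc ?_
      rintro s ⟨hs, hsu⟩
      exact hright s hs hsu
    simpa using hmem
  exact fun t ht => ⟨(hsub ht).2, hone t ht⟩

/-- If `P` is self-adjoint and joined to `1` by invertible elements, then `X* P X = 1` for some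
invertible `X`. -/
theorem exists_isUnit_star_mul_mul_eq_one {σ : A →L[ℝ] A} (hσ : ∀ x y, σ (x * y) = σ y * σ x)
    (hσσ : ∀ x, σ (σ x) = x) {P : A} (hP : σ P = P)
    (hu : ∀ a b : ℝ, 0 ≤ a → 0 ≤ b → a + b = 1 → IsUnit (a • (1 : A) + b • P)) :
    ∃ X : A, IsUnit X ∧ σ X * P * X = 1 := by
  have hσ1 := map_one_of_anti hσ hσσ
  -- This path runs from `1` at `0` to `P` at `π / 2` and stays on the segment for every real `t`,
  -- so the equation lives on an open interval containing both endpoints.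
  let Q : ℝ → A := fun t => (Real.cos t ^ 2) • (1 : A) + (Real.sin t ^ 2) • P
  let Q' : ℝ → A := fun t => (2 * Real.sin t * Real.cos t) • (P - 1)
  have hQ : ∀ t, HasDerivAt Q (Q' t) t := fun t => by
    convert! (((Real.hasDerivAt_cos t).pow 2).smul_const (1 : A)).add
      (((Real.hasDerivAt_sin t).pow 2).smul_const P) using 1
    simp only [Q']
    push_cast
    module
  have hQu : ∀ t, IsUnit (Q t) := fun t =>
    hu _ _ (sq_nonneg _) (sq_nonneg _) (Real.cos_sq_add_sin_sq t)
  have hQc : ContinuousOn Q Set.univ := fun t _ => (hQ t).continuousAt.continuousWithinAt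
  have hinv : ContinuousOn (fun t => Ring.inverse (Q t)) Set.univ :=
    contDiffOn_zero.1 (contDiffOn_ringInverse (fun t _ => hQu t) (contDiffOn_zero.2 hQc))
  have hQ'c : Continuous Q' := by fun_prop
  obtain ⟨X, hX0, hX⟩ := exists_hasDerivAt_mul isOpen_univ Set.ordConnected_univ
    (a := fun t => -(1 / 2 : ℝ) • (Ring.inverse (Q t) * Q' t))
    ((hinv.mul hQ'c.continuousOn).const_smul _) (Set.mem_univ 0) (1 : A)
  have := isUnit_and_star_mul_mul_eq_one hσ hσσ isOpen_univ Set.ordConnected_univ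
    (fun t _ => hQ t) (fun t _ => hQu t)
    (fun t _ => by simp only [Q, map_add, map_smul, hσ1, hP])
    (fun t ht => by simpa only [smul_mul_assoc] using hX t ht) (Set.mem_univ 0)
    (by rw [hX0]; exact isUnit_one) (by simp [hX0, Q, hσ1]) (Real.pi / 2) (Set.mem_univ _)
  exact ⟨X (Real.pi / 2), this.1, by simpa [Q] using this.2⟩

end BanachAlgebra

/-! ### Block operators -/

section Block

variable {E F : Type*} [NormedAddCommGroup E] [NormedSpace ℝ E] [NormedAddCommGroup F]
  [NormedSpace ℝ F]

/-- This is the form that `block` takes in `block_eq`; composition with a fixed operator is bounded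
and linear. -/
theorem hasDerivAt_comp_add_comp (i j : E →L[ℝ] F) (p q : F →L[ℝ] E) {a b c d : ℝ → E →L[ℝ] E}
    {a' b' c' d' : E →L[ℝ] E} {u : ℝ} (ha : HasDerivAt a a' u) (hb : HasDerivAt b b' u)
    (hc : HasDerivAt c c' u) (hd : HasDerivAt d d' u) :
    HasDerivAt (fun t => i ∘L (a t ∘L p + b t ∘L q) + j ∘L (c t ∘L p + d t ∘L q))
      (i ∘L (a' ∘L p + b' ∘L q) + j ∘L (c' ∘L p + d' ∘L q)) u := by
  have h : ∀ {f : ℝ → E →L[ℝ] E} {f' : E →L[ℝ] E} (r : F →L[ℝ] E), HasDerivAt f f' u →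
      HasDerivAt (fun t => f t ∘L r) (f' ∘L r) u := fun r hf =>
    ((ContinuousLinearMap.compL ℝ F E E).flip r).hasFDerivAt.comp_hasDerivAt u hf
  have h' : ∀ {f : ℝ → F →L[ℝ] E} {f' : F →L[ℝ] E} (k : E →L[ℝ] F), HasDerivAt f f' u →
      HasDerivAt (fun t => k ∘L f t) (k ∘L f') u := fun k hf =>
    ((ContinuousLinearMap.compL ℝ F E F) k).hasFDerivAt.comp_hasDerivAt u hf
  exact (h' i ((h p ha).add (h q hb))).add (h' j ((h p hc).add (h q hd)))

theorem contDiffOn_comp_add_comp (i j : E →L[ℝ] F) (p q : F →L[ℝ] E) {a b c d : ℝ → E →L[ℝ] E}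
    {U : Set ℝ} {n : WithTop ℕ∞} (ha : ContDiffOn ℝ n a U) (hb : ContDiffOn ℝ n b U)
    (hc : ContDiffOn ℝ n c U) (hd : ContDiffOn ℝ n d U) :
    ContDiffOn ℝ n (fun t => i ∘L (a t ∘L p + b t ∘L q) + j ∘L (c t ∘L p + d t ∘L q)) U := by
  have h : ∀ {f : ℝ → E →L[ℝ] E} (r : F →L[ℝ] E), ContDiffOn ℝ n f U →
      ContDiffOn ℝ n (fun t => f t ∘L r) U := fun r hf =>
    ((ContinuousLinearMap.compL ℝ F E E).flip r).contDiff.comp_contDiffOn hf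
  have h' : ∀ {f : ℝ → F →L[ℝ] E} (k : E →L[ℝ] F), ContDiffOn ℝ n f U →
      ContDiffOn ℝ n (fun t => k ∘L f t) U := fun k hf =>
    ((ContinuousLinearMap.compL ℝ F E F) k).contDiff.comp_contDiffOn hf
  exact (h' i ((h p ha).add (h q hb))).add (h' j ((h p hc).add (h q hd)))

end Block

/-! ### Adjoints with respect to a nondegenerate form -/

section Adjoint

variable {E : Type*} [NormedAddCommGroup E] [NormedSpace ℝ E] [CompleteSpace E]

/-- The adjoint with respect to a bounded bilinear form for which adjoints exist and are unique is
bounded. -/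
theorem exists_continuousLinearMap_eq_adjoint (b : E →L[ℝ] E →L[ℝ] ℝ)
    (f : (E →L[ℝ] E) → (E →L[ℝ] E)) (hf : ∀ X k l, b (X k) l = b k (f X l))
    (huniq : ∀ X Y : E →L[ℝ] E, (∀ k l, b (X k) l = b k (Y l)) → Y = f X) :
    ∃ σ : (E →L[ℝ] E) →L[ℝ] (E →L[ℝ] E), ∀ X, σ X = f X := by
  let F : (E →L[ℝ] E) →ₗ[ℝ] (E →L[ℝ] E) :=
    { toFun := f
      map_add' := fun X Y => (huniq _ _ fun k l => by simp [hf]).symm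
      map_smul' := fun c X => (huniq _ _ fun k l => by simp [hf]).symm }
  -- Closed graph theorem: the identity characterizing adjoints survives limits of both operators.
  have hcont : Continuous F := by
    refine F.continuous_of_seq_closed_graph fun u X Y hu hY => huniq _ _ fun k l => ?_
    have hev : ∀ k : E, Continuous fun X : E →L[ℝ] E => X k := fun k =>
      (ContinuousLinearMap.apply ℝ E k).continuous
    have h1 : Filter.Tendsto (fun n => b (u n k) l) Filter.atTop (𝓝 (b (X k) l)) :=
      (((b.flip l).continuous.comp (hev k)).tendsto X).comp hu
    have h2 : Filter.Tendsto (fun n => b k (f (u n) l)) Filter.atTop (𝓝 (b k (Y l))) :=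
      (((b k).continuous.comp (hev l)).tendsto Y).comp hY
    exact tendsto_nhds_unique h1 (h2.congr fun n => (hf (u n) k l).symm)
  exact ⟨⟨F, hcont⟩, fun X => rfl⟩

end Adjoint

section Symplectic

variable {T : Type*} [NormedAddCommGroup T] [InnerProductSpace ℝ T] [CompleteSpace T]

/-! ### The symplectic form and the inner product of a hyperbolic structure -/

namespace SymplecticStructure

variable (S : SymplecticStructure T)

theorem form_swap (x y : T) : S.form x y = -S.form y x := by
  rw [form, form, ← ContinuousLinearMap.adjoint_inner_left, S.adjoint_eq, neg_apply,
    inner_neg_left, real_inner_comm]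

theorem form_add_left (x y z : T) : S.form (x + y) z = S.form x z + S.form y z := by
  simp [form, inner_add_left]

theorem form_add_right (x y z : T) : S.form x (y + z) = S.form x y + S.form x z := by
  simp [form, inner_add_right]

theorem adjoint_comp_Om_comp_eq_iff (g : T →L[ℝ] T) :
    ContinuousLinearMap.adjoint g ∘L S.Om ∘L g = S.Om ↔ ∀ x y, S.form (g x) (g y) = S.form x y := by
  constructor
  · intro h x y
    have := congrArg (fun F : T →L[ℝ] T => inner ℝ x (F y)) h
    simpa [ContinuousLinearMap.adjoint_inner_right, form] using this
  · intro h
    ext y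
    refine ext_inner_left ℝ fun x => ?_
    simpa [ContinuousLinearMap.adjoint_inner_right, form] using h x y

end SymplecticStructure

namespace HyperbolicStructure

variable {S : SymplecticStructure T} (P : HyperbolicStructure S)

instance : CompleteSpace P.plus :=
  (ContinuousLinearMap.isClosed_ker (ContinuousLinearMap.id ℝ T - P.K)).completeSpace_coe

/-- The inner product `g` as a bounded bilinear form. -/
def gL : T →L[ℝ] T →L[ℝ] ℝ := (innerSL ℝ).bilinearComp P.J S.Om

theorem gL_apply (x y : T) : P.gL x y = P.g x y := rfl

theorem g_add_left (x y z : T) : P.g (x + y) z = P.g x z + P.g y z := by simp [← gL_apply]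
theorem g_add_right (x y z : T) : P.g x (y + z) = P.g x y + P.g x z := by simp [← gL_apply]
theorem g_sub_left (x y z : T) : P.g (x - y) z = P.g x z - P.g y z := by simp [← gL_apply]
theorem g_sub_right (x y z : T) : P.g x (y - z) = P.g x y - P.g x z := by simp [← gL_apply]
theorem g_smul_left (c : ℝ) (x y : T) : P.g (c • x) y = c * P.g x y := by simp [← gL_apply]
theorem g_smul_right (c : ℝ) (x y : T) : P.g x (c • y) = c * P.g x y := by simp [← gL_apply]

theorem g_self_nonneg (x : T) : 0 ≤ P.g x x := by
  rcases eq_or_ne x 0 with rfl | h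
  · simp [← gL_apply]
  · exact (P.g_self_pos h).le

theorem ext_g {k l : P.plus} (h : ∀ m : P.plus, P.g k m = P.g l m) : k = l := by
  by_contra hne
  have h1 := P.g_self_pos (x := (k : T) - l) (sub_ne_zero.2 fun h => hne (Subtype.ext h))
  have h2 := h (k - l)
  rw [Submodule.coe_sub] at h2
  rw [g_sub_left, h2, sub_self] at h1
  exact h1.false

/-- Strict positivity alone is not coercivity in infinite dimension; boundedness of the inverse `Z`
of `G` is what helps. Cauchy–Schwarz for `g` at `x` and `G x` bounds `‖G x‖²` by `‖G‖ g(x, x)`, and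
`‖x‖ ≤ ‖Z‖ ‖G x‖`. -/
theorem g_coercive : ∃ c, 0 < c ∧ ∀ x, c * ‖x‖ * ‖x‖ ≤ P.g x x := by
  let G : T →L[ℝ] T := -(S.Om ∘L P.J)
  let Z : T →L[ℝ] T := -(P.J ∘L S.Om)
  have hO : ∀ x, S.Om (S.Om x) = -x := fun x => congrArg (fun F : T →L[ℝ] T => F x) S.sq_eq
  have hZG : ∀ x, Z (G x) = x := fun x => by simp [G, Z, P.J_sq, hO]
  have hg : ∀ x y, P.g x y = inner ℝ x (G y) := fun x y => P.g_eq x y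
  -- The summand `1` only keeps the constant positive when `T` is trivial.
  have key : ∀ x, ‖x‖ * ‖x‖ ≤ (‖Z‖ ^ 2 * ‖G‖ + 1) * P.g x x := fun x => by
    have h0 := P.g_self_nonneg x
    have hGx : ‖G x‖ ^ 2 ≤ ‖G‖ * P.g x x := by
      rcases eq_or_ne (G x) 0 with h | h
      · rw [h, norm_zero, zero_pow two_ne_zero]
        exact mul_nonneg (norm_nonneg _) h0
      have hcs := LinearMap.BilinForm.apply_mul_apply_le_of_forall_zero_le
        (LinearMap.mk₂ ℝ P.g P.g_add_left P.g_smul_left P.g_add_right P.g_smul_right)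
        P.g_self_nonneg x (G x)
      simp only [LinearMap.mk₂_apply] at hcs
      rw [P.g_comm (G x) x, hg x (G x), ← ContinuousLinearMap.adjoint_inner_left] at hcs
      have hadj : ∀ y, inner ℝ (ContinuousLinearMap.adjoint G x) y = inner ℝ (G x) y := fun y => by
        rw [ContinuousLinearMap.adjoint_inner_left, ← hg, P.g_comm, hg, real_inner_comm]
      rw [hadj, real_inner_self_eq_norm_sq] at hcs
      have h2 : P.g (G x) (G x) ≤ ‖G‖ * ‖G x‖ ^ 2 := by
        rw [hg]
        refine (real_inner_le_norm _ _).trans ?_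
        nlinarith [G.le_opNorm (G x), norm_nonneg (G x)]
      have h3 : 0 < ‖G x‖ ^ 2 := by positivity
      refine le_of_mul_le_mul_right ?_ h3
      nlinarith
    have hx : ‖x‖ ≤ ‖Z‖ * ‖G x‖ := by
      nth_rw 1 [← hZG x]
      exact Z.le_opNorm _
    calc ‖x‖ * ‖x‖ ≤ (‖Z‖ * ‖G x‖) * (‖Z‖ * ‖G x‖) := by gcongr
      _ = ‖Z‖ ^ 2 * ‖G x‖ ^ 2 := by ring
      _ ≤ ‖Z‖ ^ 2 * (‖G‖ * P.g x x) := by gcongr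
      _ ≤ _ := by linarith
  have hpos : 0 < ‖Z‖ ^ 2 * ‖G‖ + 1 := by positivity
  refine ⟨(‖Z‖ ^ 2 * ‖G‖ + 1)⁻¹, by positivity, fun x => ?_⟩
  rw [mul_assoc, inv_mul_le_iff₀ hpos]
  exact key x

/-! ### Adjoints -/

theorem g_adj' (X : P.plus →L[ℝ] P.plus) (k l : P.plus) : P.g (P.adj X k) l = P.g k (X l) := by
  rw [P.g_comm, ← P.g_adj, P.g_comm]

theorem adj_mul (X Y : P.plus →L[ℝ] P.plus) : P.adj (X * Y) = P.adj Y * P.adj X :=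
  (P.eq_adj _ _ fun k l => by
    simp only [mul_apply_eq_comp, g_adj]).symm

theorem adj_adj (X : P.plus →L[ℝ] P.plus) : P.adj (P.adj X) = X :=
  (P.eq_adj _ _ fun k l => P.g_adj' X k l).symm

/-- A bounded linear `σ` can be differentiated through, so the Banach algebra results apply to
operators on `K₊`. -/
theorem exists_adjL : ∃ σ : (P.plus →L[ℝ] P.plus) →L[ℝ] (P.plus →L[ℝ] P.plus),
    ∀ X, σ X = P.adj X :=
  exists_continuousLinearMap_eq_adjoint (P.gL.bilinearComp P.plus.subtypeL P.plus.subtypeL)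
    P.adj P.g_adj P.eq_adj

theorem isOrthogonal_iff (R : P.plus →L[ℝ] P.plus) :
    P.IsOrthogonal R ↔ P.adj R * R = 1 ∧ R * P.adj R = 1 := by
  constructor
  · rintro ⟨hs, hg⟩
    have h1 : P.adj R * R = 1 := by
      ext1 k
      refine P.ext_g fun l => ?_
      rw [mul_apply_eq_comp, g_adj', hg, one_apply_eq_self]
    refine ⟨h1, ?_⟩
    ext1 k
    obtain ⟨l, rfl⟩ := hs k
    rw [← mul_apply_eq_comp, mul_assoc, h1]
    rfl
  · rintro ⟨h1, h2⟩
    refine ⟨fun k => ⟨P.adj R k, congrArg (fun F : P.plus →L[ℝ] P.plus => F k) h2⟩, fun k l => ?_⟩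
    rw [g_adj, ← mul_apply_eq_comp, h1]
    rfl

/-- `a + b A` is invertible if `A` is positive semidefinite and invertible, and `a, b ≥ 0`
with `a + b = 1`. -/
theorem isUnit_smul_one_add_smul {X : P.plus →L[ℝ] P.plus} (hX : IsUnit X)
    (hpos : ∀ k : P.plus, 0 ≤ P.g (X k) k) {a b : ℝ} (ha : 0 ≤ a) (hb : 0 ≤ b) (hab : a + b = 1) :
    IsUnit (a • (1 : P.plus →L[ℝ] P.plus) + b • X) := by
  -- Coercivity needs `a > 0`; at `a = 0` the invertibility of `X` is used instead.
  rcases ha.eq_or_lt with rfl | ha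
  · obtain rfl : b = 1 := by linarith
    have h : (0 : ℝ) • (1 : P.plus →L[ℝ] P.plus) + (1 : ℝ) • X = X := by
      ext1 k
      exact (congrArg₂ (· + ·) (zero_smul ℝ k) (one_smul ℝ (X k))).trans (zero_add _)
    rwa [h]
  obtain ⟨c, hc, hcoer⟩ := P.g_coercive
  let B : (P.plus →L[ℝ] P.plus) → P.plus →L[ℝ] P.plus →L[ℝ] ℝ := fun W =>
    P.gL.bilinearComp (P.plus.subtypeL ∘L W) P.plus.subtypeL
  have hB : ∀ W k l, B W k l = P.g (W k) l := fun W k l => rfl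
  set W : P.plus →L[ℝ] P.plus := a • 1 + b • X with hW
  have h1 : IsCoercive (B 1) := ⟨c, hc, fun k => hcoer k⟩
  have h2 : IsCoercive (B W) := ⟨a * c, by positivity, fun k => by
    have h3 := hcoer k
    have h4 := mul_nonneg hb (hpos k)
    have h5 : B W k k = a * P.g k k + b * P.g (X k) k := by
      rw [hB, hW, ← g_smul_left, ← g_smul_left, ← g_add_left]
      rfl
    rw [h5]
    have : a * (c * ‖k‖ * ‖k‖) ≤ a * P.g k k := mul_le_mul_of_nonneg_left h3 ha.le
    linarith⟩
  -- The Lax–Milgram operator of `g(W ·, ·)` is that of `g` composed with `W`, so `W` is a quotient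
  -- of two equivalences.
  have h3 : ∀ k, h2.continuousLinearEquivOfBilin k = h1.continuousLinearEquivOfBilin (W k) :=
    fun k => ext_inner_right ℝ fun l => by
      simp only [IsCoercive.continuousLinearEquivOfBilin_apply, hB]
      rfl
  rw [ContinuousLinearMap.isUnit_iff_bijective]
  have h4 : ⇑W = h1.continuousLinearEquivOfBilin.symm ∘ h2.continuousLinearEquivOfBilin := by
    funext k
    simp [h3]
  rw [h4]
  exact (ContinuousLinearEquiv.bijective _).comp (ContinuousLinearEquiv.bijective _)

/-! ### Block matrices -/

theorem form_J_J (x y : T) : S.form (P.J x) (P.J y) = S.form x y :=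
  (S.adjoint_comp_Om_comp_eq_iff P.J).1 P.canonical x y

theorem form_K_K (x y : T) : S.form (P.K x) (P.K y) = -S.form x y := by
  have := congrArg (fun F : T →L[ℝ] T => inner ℝ x (F y)) P.anticanonical
  simpa [ContinuousLinearMap.adjoint_inner_right, SymplecticStructure.form] using this

theorem form_plus (k l : P.plus) : S.form k l = 0 := by
  have h := P.form_K_K k l
  rw [P.mem_plus.1 k.2, P.mem_plus.1 l.2] at h
  linarith

/-- `K₊` and `J K₊` are both isotropic, so only the mixed pairings survive and `ω` takes its
standard form. -/
theorem form_split_symm (k l k' l' : P.plus) :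
    S.form (k + P.J l) (k' + P.J l') = P.g l k' - P.g k l' := by
  have h : S.form k (P.J l') = -P.g k l' := by
    rw [S.form_swap, P.g_comm]
    rfl
  rw [S.form_add_left, S.form_add_right, S.form_add_right, P.form_plus, P.form_J_J, P.form_plus, h]
  change 0 + -P.g k l' + (P.g l k' + 0) = _
  ring

theorem fst_add_J_snd (x : T) : (P.fst x : T) + P.J (P.snd x) = x := P.split.symm_apply_apply x

theorem fst_split_symm (k l : P.plus) : P.fst (k + P.J l) = k :=
  congrArg Prod.fst (P.split.apply_symm_apply (k, l))

theorem snd_split_symm (k l : P.plus) : P.snd (k + P.J l) = l :=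
  congrArg Prod.snd (P.split.apply_symm_apply (k, l))

theorem form_eq (x y : T) : S.form x y = P.g (P.snd x) (P.fst y) - P.g (P.fst x) (P.snd y) := by
  rw [← P.form_split_symm, fst_add_J_snd, fst_add_J_snd]

theorem ext_fst_snd {x y : T} (h1 : P.fst x = P.fst y) (h2 : P.snd x = P.snd y) : x = y := by
  rw [← P.fst_add_J_snd x, h1, h2, fst_add_J_snd]

@[simp] theorem fst_coe (k : P.plus) : P.fst (k : T) = k := by
  simpa using P.fst_split_symm k 0

@[simp] theorem snd_coe (k : P.plus) : P.snd (k : T) = 0 := by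
  simpa using P.snd_split_symm k 0

@[simp] theorem fst_J (k : P.plus) : P.fst (P.J k) = 0 := by
  simpa using P.fst_split_symm 0 k

@[simp] theorem snd_J (k : P.plus) : P.snd (P.J k) = k := by
  simpa using P.snd_split_symm 0 k

theorem mem_plus_iff_snd {x : T} : x ∈ P.plus ↔ P.snd x = 0 := by
  constructor
  · intro h
    exact P.snd_coe ⟨x, h⟩
  · intro h
    rw [← P.fst_add_J_snd x, h]
    simp

theorem mem_minus_iff_fst {x : T} : x ∈ P.minus ↔ P.fst x = 0 := by
  rw [mem_minus, ← Subtype.coe_inj, coe_fst, Submodule.coe_zero, smul_eq_zero]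
  simp [add_eq_zero_iff_eq_neg']

@[simp] theorem fst_block (A B C D : P.plus →L[ℝ] P.plus) (x : T) :
    P.fst (P.block A B C D x) = A (P.fst x) + B (P.snd x) := P.fst_split_symm _ _

@[simp] theorem snd_block (A B C D : P.plus →L[ℝ] P.plus) (x : T) :
    P.snd (P.block A B C D x) = C (P.fst x) + D (P.snd x) := P.snd_split_symm _ _

theorem block_apply_eq (N : T →L[ℝ] T) : N = P.block (P.fst ∘L N ∘L P.plus.subtypeL)
    (P.fst ∘L N ∘L P.J ∘L P.plus.subtypeL) (P.snd ∘L N ∘L P.plus.subtypeL)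
    (P.snd ∘L N ∘L P.J ∘L P.plus.subtypeL) := by
  ext1 x
  apply P.ext_fst_snd <;>
    simp [← map_add, fst_add_J_snd]

theorem block_inj {A B C D A' B' C' D' : P.plus →L[ℝ] P.plus} :
    P.block A B C D = P.block A' B' C' D' ↔ A = A' ∧ B = B' ∧ C = C' ∧ D = D' := by
  refine ⟨fun h => ?_, by rintro ⟨rfl, rfl, rfl, rfl⟩; rfl⟩
  have h1 : ∀ k : P.plus, P.block A B C D k = P.block A' B' C' D' k := fun k => by rw [h]
  have h2 : ∀ k : P.plus, P.block A B C D (P.J k) = P.block A' B' C' D' (P.J k) :=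
    fun k => by rw [h]
  refine ⟨?_, ?_, ?_, ?_⟩ <;> ext1 k
  · simpa using congrArg P.fst (h1 k)
  · simpa using congrArg P.fst (h2 k)
  · simpa using congrArg P.snd (h1 k)
  · simpa using congrArg P.snd (h2 k)

theorem block_eq (A B C D : P.plus →L[ℝ] P.plus) :
    P.block A B C D = P.plus.subtypeL ∘L (A ∘L P.fst + B ∘L P.snd) +
      (P.J ∘L P.plus.subtypeL) ∘L (C ∘L P.fst + D ∘L P.snd) := rfl

theorem hasDerivAt_block {a b c d : ℝ → P.plus →L[ℝ] P.plus} {a' b' c' d' : P.plus →L[ℝ] P.plus}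
    {u : ℝ} (ha : HasDerivAt a a' u) (hb : HasDerivAt b b' u) (hc : HasDerivAt c c' u)
    (hd : HasDerivAt d d' u) :
    HasDerivAt (fun t => P.block (a t) (b t) (c t) (d t)) (P.block a' b' c' d') u := by
  simp only [block_eq]
  exact hasDerivAt_comp_add_comp _ _ _ _ ha hb hc hd

theorem contDiffOn_block {a b c d : ℝ → P.plus →L[ℝ] P.plus} {U : Set ℝ} {n : WithTop ℕ∞}
    (ha : ContDiffOn ℝ n a U) (hb : ContDiffOn ℝ n b U) (hc : ContDiffOn ℝ n c U)
    (hd : ContDiffOn ℝ n d U) :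
    ContDiffOn ℝ n (fun t => P.block (a t) (b t) (c t) (d t)) U := by
  simp only [block_eq]
  exact contDiffOn_comp_add_comp _ _ _ _ ha hb hc hd

/-- The three relations are the pairings under `ω` of left with left, right with right, and right
with left columns; the remaining pairing follows by symmetry. -/
theorem isCanonical_block {A B C D : P.plus →L[ℝ] P.plus}
    (hu : IsUnit (P.block A B C D)) (h1 : P.adj C * A = P.adj A * C)
    (h2 : P.adj D * B = P.adj B * D) (h3 : P.adj D * A - P.adj B * C = 1) :
    S.IsCanonical (P.block A B C D) := by
  refine ⟨ContinuousLinearMap.isUnit_iff_bijective.1 hu,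
    (S.adjoint_comp_Om_comp_eq_iff _).2 fun x y => ?_⟩
  have e1 : ∀ k l : P.plus, P.g (C k) (A l) = P.g (A k) (C l) := fun k l => by
    rw [g_adj, g_adj, ← mul_apply_eq_comp, h1, mul_apply_eq_comp]
  have e2 : ∀ k l : P.plus, P.g (D k) (B l) = P.g (B k) (D l) := fun k l => by
    rw [g_adj, g_adj, ← mul_apply_eq_comp, h2, mul_apply_eq_comp]
  have e3 : ∀ k l : P.plus, P.g (D k) (A l) - P.g (B k) (C l) = P.g k l := fun k l => by
    rw [g_adj, g_adj, ← g_sub_right]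
    exact congrArg (fun F : P.plus →L[ℝ] P.plus => P.g k (F l)) h3
  rw [P.form_eq, P.form_eq x y]
  simp only [fst_block, snd_block, Submodule.coe_add, g_add_left, g_add_right]
  have f1 := e1 (P.fst x) (P.fst y)
  have f2 := e2 (P.snd x) (P.snd y)
  have f3 := e3 (P.snd x) (P.fst y)
  have f4 := e3 (P.snd y) (P.fst x)
  rw [P.g_comm (D _), P.g_comm (B _), P.g_comm (P.snd y)] at f4
  linarith

theorem adj_mul_sub_of_isCanonical {A B C D : P.plus →L[ℝ] P.plus}
    (h : S.IsCanonical (P.block A B C D)) : P.adj D * A - P.adj B * C = 1 := by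
  ext1 l
  refine P.ext_g fun k => ?_
  have := (S.adjoint_comp_Om_comp_eq_iff _).1 h.2 (P.J k) l
  rw [P.form_eq, P.form_eq (P.J k)] at this
  simp only [fst_block, snd_block, fst_coe, snd_coe, fst_J, snd_J, map_zero, zero_add,
    add_zero] at this
  have h0 : P.g (0 : P.plus) (0 : P.plus) = 0 := by simp [← gL_apply]
  rw [h0, sub_zero, P.g_comm (D k), P.g_comm (B k), P.g_comm k, ← g_adj', ← g_adj'] at this
  rw [one_apply_eq_self, ← this, sub_apply, Submodule.coe_sub, g_sub_left]
  rfl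

/-! ### Lagrangian subspaces -/

/-- Maximality: a vector `ω`-orthogonal to all of `J K₊` has vanishing `K₊` component. -/
theorem isLagrangian_minus : S.IsLagrangian P.minus := by
  refine ⟨fun x hx y hy => ?_, fun Y hY hle y hy => ?_⟩
  · rw [mem_minus_iff_fst] at hx hy
    rw [P.form_eq, hx, hy]
    simp [← gL_apply]
  · rw [mem_minus_iff_fst]
    refine P.ext_g fun m => ?_
    have hm : P.J m ∈ P.minus := P.mem_minus_iff_fst.2 (P.fst_J m)
    have := hY y hy _ (hle hm)
    rw [P.form_eq] at this
    simpa [← gL_apply] using this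

theorem mem_graph {H : P.plus →L[ℝ] P.plus} {x : T} :
    x ∈ P.graph H ↔ P.fst x = H (P.snd x) := by
  constructor
  · rintro ⟨k, rfl⟩
    simp
  · intro h
    refine ⟨P.snd x, ?_⟩
    apply P.ext_fst_snd <;> simp [h]

end HyperbolicStructure

end Symplectic

/-! ### The Schwarzian in a Banach algebra with a continuous anti-involution -/

section Schwarzian

variable {A : Type*} [NormedRing A] [NormedAlgebra ℝ A] {U : Set ℝ}

theorem hasDerivAt_of_contDiffOn {E : Type*} [NormedAddCommGroup E] [NormedSpace ℝ E]
    {f : ℝ → E} (hU : IsOpen U) (hf : ContDiffOn ℝ ∞ f U) {u : ℝ}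
    (hu : u ∈ U) : HasDerivAt f (deriv f u) u :=
  ((hf.differentiableOn (by simp)).differentiableAt (hU.mem_nhds hu)).hasDerivAt

theorem contDiffOn_iteratedDeriv {E : Type*} [NormedAddCommGroup E] [NormedSpace ℝ E]
    {f : ℝ → E} (hU : IsOpen U) (hf : ContDiffOn ℝ ∞ f U) (n : ℕ) :
    ContDiffOn ℝ ∞ (iteratedDeriv n f) U := by
  induction n with
  | zero => simpa using hf
  | succ n ih =>
    rw [iteratedDeriv_succ]
    exact ((contDiffOn_infty_iff_deriv_of_isOpen hU).1 ih).2

theorem hasDerivAt_iteratedDeriv {E : Type*} [NormedAddCommGroup E] [NormedSpace ℝ E]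
    {f : ℝ → E} (hU : IsOpen U) (hf : ContDiffOn ℝ ∞ f U) (n : ℕ) {u : ℝ} (hu : u ∈ U) :
    HasDerivAt (iteratedDeriv n f) (iteratedDeriv (n + 1) f u) u := by
  rw [iteratedDeriv_succ]
  exact hasDerivAt_of_contDiffOn hU (contDiffOn_iteratedDeriv hU hf n) hu

theorem map_iteratedDeriv {σ : A →L[ℝ] A} (hU : IsOpen U) {f : ℝ → A} (hf : ContDiffOn ℝ ∞ f U)
    (hfσ : ∀ t ∈ U, σ (f t) = f t) (n : ℕ) :
    ∀ u ∈ U, σ (iteratedDeriv n f u) = iteratedDeriv n f u := by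
  induction n with
  | zero => simpa using hfσ
  | succ n ih => exact fun u hu =>
      map_hasDerivAt_of_map_eq hU ih hu (hasDerivAt_iteratedDeriv hU hf n hu)

/-- `X(u)` is invertible, `X' = -½ H'⁻¹ H'' X` and `X X* = H'⁻¹` on `U`. -/
structure IsSchwarzFrame (σ : A →L[ℝ] A) (U : Set ℝ) (H X : ℝ → A) : Prop where
  isUnit : ∀ u ∈ U, IsUnit (X u)
  hasDerivAt : ∀ u ∈ U, HasDerivAt X
    (-(1 / 2 : ℝ) • (Ring.inverse (deriv H u) * iteratedDeriv 2 H u * X u)) u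
  mul_star : ∀ u ∈ U, X u * σ (X u) = Ring.inverse (deriv H u)

/-- The algebraic Schwarzian `½ X* (2 H''' - 3 H'' H'⁻¹ H'') X`. -/
def algSchwarzian (σ : A →L[ℝ] A) (H X : ℝ → A) (u : ℝ) : A :=
  (1 / 2 : ℝ) • (σ (X u) *
    ((2 : ℝ) • iteratedDeriv 3 H u -
      (3 : ℝ) • (iteratedDeriv 2 H u * Ring.inverse (deriv H u) * iteratedDeriv 2 H u)) * X u)

/-- This and its converse below pass between the stated normalization and the quantity conserved by
the equation. -/
theorem star_mul_mul_eq_one_of_mul_star_eq {σ : A →L[ℝ] A} {X p : A} (hX : IsUnit X)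
    (hp : IsUnit p) (h : X * σ X = Ring.inverse p) : σ X * p * X = 1 := by
  have h1 : X * (σ X * p * X) = X * 1 := by
    rw [← mul_assoc, ← mul_assoc, h, Ring.inverse_mul_cancel _ hp, one_mul, mul_one]
  exact hX.mul_left_cancel h1

theorem mul_star_eq_of_star_mul_mul_eq_one {σ : A →L[ℝ] A} {X p : A} (hX : IsUnit X)
    (hp : IsUnit p) (h : σ X * p * X = 1) : X * σ X = Ring.inverse p := by
  have h1 : X * (σ X * p) = 1 := by
    refine hX.mul_right_cancel ?_
    rw [mul_assoc, h, one_mul, mul_one]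
  rw [← one_mul (Ring.inverse p), ← h1, mul_assoc, mul_assoc, Ring.mul_inverse_cancel _ hp, mul_one]

variable {σ : A →L[ℝ] A} {H X : ℝ → A}

theorem exists_isSchwarzFrame [CompleteSpace A] (hσ : ∀ x y, σ (x * y) = σ y * σ x)
    (hσσ : ∀ x, σ (σ x) = x)
    (hU : IsOpen U) (hU' : U.OrdConnected) (hH : ContDiffOn ℝ ∞ H U)
    (hHσ : ∀ u ∈ U, σ (H u) = H u)
    (hH1 : ∀ u ∈ U, ∀ a b : ℝ, 0 ≤ a → 0 ≤ b → a + b = 1 →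
      IsUnit (a • (1 : A) + b • deriv H u)) : ∃ X, IsSchwarzFrame σ U H X := by
  rcases U.eq_empty_or_nonempty with rfl | ⟨u₀, hu₀⟩
  · exact ⟨0, ⟨by simp, by simp, by simp⟩⟩
  have hunit : ∀ u ∈ U, IsUnit (deriv H u) := fun u hu => by
    simpa using hH1 u hu 0 1 le_rfl zero_le_one (zero_add 1)
  have hsa : ∀ u ∈ U, σ (deriv H u) = deriv H u := fun u hu => by
    simpa using map_iteratedDeriv hU hH hHσ 1 u hu
  have h1 : ContDiffOn ℝ ∞ (deriv H) U := by
    simpa using contDiffOn_iteratedDeriv hU hH 1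
  have h2 := contDiffOn_iteratedDeriv hU hH 2
  obtain ⟨X₀, hX₀, hX₀'⟩ := exists_isUnit_star_mul_mul_eq_one hσ hσσ (hsa u₀ hu₀) (hH1 u₀ hu₀)
  obtain ⟨X, hXu₀, hX⟩ := exists_hasDerivAt_mul hU hU'
    (a := fun u => -(1 / 2 : ℝ) • (Ring.inverse (deriv H u) * iteratedDeriv 2 H u))
    (((contDiffOn_ringInverse hunit h1).continuousOn.mul h2.continuousOn).const_smul _) hu₀ X₀
  have hX' : ∀ u ∈ U, HasDerivAt X
      (-(1 / 2 : ℝ) • (Ring.inverse (deriv H u) * iteratedDeriv 2 H u * X u)) u := fun u hu => by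
    simpa only [smul_mul_assoc] using hX u hu
  have hP : ∀ u ∈ U, HasDerivAt (deriv H) (iteratedDeriv 2 H u) u := fun u hu => by
    simpa using hasDerivAt_iteratedDeriv hU hH 1 hu
  have key := isUnit_and_star_mul_mul_eq_one hσ hσσ hU hU' hP hunit hsa hX' hu₀
    (by rwa [hXu₀]) (by rwa [hXu₀])
  exact ⟨X, fun u hu => (key u hu).1, hX', fun u hu =>
    mul_star_eq_of_star_mul_mul_eq_one (key u hu).1 (hunit u hu) (key u hu).2⟩

namespace IsSchwarzFrame

theorem contDiffOn [CompleteSpace A] (hX : IsSchwarzFrame σ U H X) (hU : IsOpen U)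
    (hH : ContDiffOn ℝ ∞ H U)
    (hH1 : ∀ u ∈ U, IsUnit (deriv H u)) : ContDiffOn ℝ ∞ X U := by
  have h1 : ContDiffOn ℝ ∞ (deriv H) U := by
    simpa using contDiffOn_iteratedDeriv hU hH 1
  refine contDiffOn_of_hasDerivAt_mul hU
    (a := fun u => -(1 / 2 : ℝ) • (Ring.inverse (deriv H u) * iteratedDeriv 2 H u))
    (((contDiffOn_ringInverse hH1 h1).mul (contDiffOn_iteratedDeriv hU hH 2)).const_smul _)
    fun t ht => ?_
  simpa only [smul_mul_assoc] using hX.hasDerivAt t ht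

theorem deriv_mul_eq (hX : IsSchwarzFrame σ U H X) (hU : IsOpen U)
    (hH : ContDiffOn ℝ ∞ H U)
    {u : ℝ} (hu : u ∈ U) :
    deriv (fun t => H t * X t) u = deriv H u * X u + H u * deriv X u := by
  rw [(hX.hasDerivAt u hu).deriv]
  exact ((hasDerivAt_of_contDiffOn hU hH hu).mul (hX.hasDerivAt u hu)).deriv

/-- The second derivative of a frame. -/
theorem hasDerivAt_deriv [CompleteSpace A] (hX : IsSchwarzFrame σ U H X) (hU : IsOpen U)
    (hH : ContDiffOn ℝ ∞ H U)
    (hH1 : ∀ u ∈ U, IsUnit (deriv H u)) {u : ℝ} (hu : u ∈ U) :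
    HasDerivAt (deriv X) (X u * (-(1 / 2 : ℝ) • algSchwarzian σ H X u)) u := by
  have e1 : HasDerivAt (deriv H) (iteratedDeriv 2 H u) u := by
    simpa using hasDerivAt_iteratedDeriv hU hH 1 hu
  have e2 := hasDerivAt_iteratedDeriv hU hH 2 hu
  have h := (((hasDerivAt_ringInverse (hH1 u hu) e1).mul e2).mul
    (hX.hasDerivAt u hu)).const_smul (-(1 / 2 : ℝ))
  have heq : deriv X =ᶠ[𝓝 u] fun u =>
      -(1 / 2 : ℝ) • (Ring.inverse (deriv H u) * iteratedDeriv 2 H u * X u) := by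
    filter_upwards [hU.mem_nhds hu] with t ht using (hX.hasDerivAt t ht).deriv
  refine (h.congr_of_eventuallyEq heq).congr_deriv ?_
  -- The factor `X X*` in `X S` becomes `H'⁻¹`, after which both sides are polynomials in `H'⁻¹`,
  -- `H''`, `H'''` times `X`.
  rw [algSchwarzian, mul_smul_comm (-(1 / 2 : ℝ)) (X u), mul_smul_comm (1 / 2 : ℝ) (X u),
    ← mul_assoc (X u), ← mul_assoc (X u), hX.mul_star u hu]
  simp only [Pi.mul_apply, mul_assoc, mul_sub, sub_mul, add_mul, mul_smul_comm,
    smul_mul_assoc, neg_mul]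
  module

/-- The second derivative of `H X` for a frame `X`. -/
theorem hasDerivAt_deriv_mul [CompleteSpace A] (hX : IsSchwarzFrame σ U H X) (hU : IsOpen U)
    (hH : ContDiffOn ℝ ∞ H U) (hH1 : ∀ u ∈ U, IsUnit (deriv H u)) {u : ℝ} (hu : u ∈ U) :
    HasDerivAt (deriv fun t => H t * X t)
      (H u * X u * (-(1 / 2 : ℝ) • algSchwarzian σ H X u)) u := by
  have e0 := hasDerivAt_of_contDiffOn hU hH hu
  have e1 : HasDerivAt (deriv H) (iteratedDeriv 2 H u) u := by
    simpa using hasDerivAt_iteratedDeriv hU hH 1 hu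
  have h := (e1.mul (hX.hasDerivAt u hu)).add (e0.mul (hX.hasDerivAt_deriv hU hH hH1 hu))
  have heq : (deriv fun t => H t * X t) =ᶠ[𝓝 u] fun t => deriv H t * X t + H t * deriv X t := by
    filter_upwards [hU.mem_nhds hu] with t ht using hX.deriv_mul_eq hU hH ht
  refine (h.congr_of_eventuallyEq heq).congr_deriv ?_
  -- The frame equation is `H'' X + 2 H' X' = 0`; these terms drop out and only `H X''` remains.
  rw [(hX.hasDerivAt u hu).deriv]
  simp only [mul_assoc, mul_smul_comm, Ring.mul_inverse_cancel_left _ _ (hH1 u hu)]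
  module

theorem map_algSchwarzian (hσ : ∀ x y, σ (x * y) = σ y * σ x) (hσσ : ∀ x, σ (σ x) = x)
    (hU : IsOpen U) (hH : ContDiffOn ℝ ∞ H U) (hHσ : ∀ u ∈ U, σ (H u) = H u)
    (hH1 : ∀ u ∈ U, IsUnit (deriv H u)) {u : ℝ} (hu : u ∈ U) (X : ℝ → A) :
    σ (algSchwarzian σ H X u) = algSchwarzian σ H X u := by
  have h1 : σ (deriv H u) = deriv H u := by
    simpa using map_iteratedDeriv hU hH hHσ 1 u hu
  simp only [algSchwarzian, map_smul, map_sub, hσ, hσσ, map_iteratedDeriv hU hH hHσ _ u hu,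
    map_ringInverse hσ hσσ (hH1 u hu) h1, mul_assoc]

/-- The symplectic relations between the columns of `[[Y', Y], [X', X]]`, `Y = H X`. -/
theorem symplectic_relations (hX : IsSchwarzFrame σ U H X) (hσ : ∀ x y, σ (x * y) = σ y * σ x)
    (hσσ : ∀ x, σ (σ x) = x) (hU : IsOpen U) (hH : ContDiffOn ℝ ∞ H U)
    (hHσ : ∀ u ∈ U, σ (H u) = H u) (hH1 : ∀ u ∈ U, IsUnit (deriv H u)) {u : ℝ} (hu : u ∈ U) :
    σ (deriv X u) * deriv (fun t => H t * X t) u =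
        σ (deriv (fun t => H t * X t) u) * deriv X u ∧
      σ (X u) * (H u * X u) = σ (H u * X u) * X u ∧
      σ (X u) * deriv (fun t => H t * X t) u - σ (H u * X u) * deriv X u = 1 := by
  have h1 : σ (deriv H u) = deriv H u := by
    simpa using map_iteratedDeriv hU hH hHσ 1 u hu
  have h2 := map_iteratedDeriv hU hH hHσ 2 u hu
  have h3 := map_ringInverse hσ hσσ (hH1 u hu) h1
  refine ⟨?_, ?_, ?_⟩
  · rw [hX.deriv_mul_eq hU hH hu, mul_add, map_add, hσ, hσ, hHσ u hu, h1, add_mul]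
    -- The first summands both equal `-½ X* H'' X`; the second ones agree since `H` is self-adjoint.
    congr 1
    · rw [(hX.hasDerivAt u hu).deriv]
      simp only [map_smul, hσ, h2, h3, mul_assoc, smul_mul_assoc, mul_smul_comm,
        Ring.mul_inverse_cancel_left _ _ (hH1 u hu), Ring.inverse_mul_cancel_left _ _ (hH1 u hu)]
    · rw [mul_assoc]
  · rw [hσ, hHσ u hu, mul_assoc]
  · rw [hX.deriv_mul_eq hU hH hu, mul_add, hσ, hHσ u hu, mul_assoc, add_sub_cancel_right,
      ← mul_assoc]
    exact star_mul_mul_eq_one_of_mul_star_eq (hX.isUnit u hu) (hH1 u hu) (hX.mul_star u hu)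

theorem mul_right (hX : IsSchwarzFrame σ U H X) (hσ : ∀ x y, σ (x * y) = σ y * σ x) {R : A}
    (hR : σ R * R = 1) (hR' : R * σ R = 1) : IsSchwarzFrame σ U H fun u => X u * R where
  isUnit u hu := (hX.isUnit u hu).mul ⟨⟨R, σ R, hR', hR⟩, rfl⟩
  hasDerivAt u hu := by
    refine ((hX.hasDerivAt u hu).mul_const R).congr_deriv ?_
    rw [smul_mul_assoc, mul_assoc _ _ R]
  mul_star u hu := by
    rw [hσ, ← hX.mul_star u hu, mul_assoc, ← mul_assoc R, hR', one_mul]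

theorem deriv_mul_right (hX : IsSchwarzFrame σ U H X) (hU : IsOpen U)
    (hH : ContDiffOn ℝ ∞ H U)
    {X' : ℝ → A} {R : A} (hX' : ∀ u ∈ U, X' u = X u * R) {u : ℝ} (hu : u ∈ U) :
    deriv X' u = deriv X u * R ∧
      deriv (fun t => H t * X' t) u = deriv (fun t => H t * X t) u * R := by
  have e1 : X' =ᶠ[𝓝 u] fun t => X t * R := by
    filter_upwards [hU.mem_nhds hu] with t ht using hX' t ht
  have e2 : (fun t => H t * X' t) =ᶠ[𝓝 u] fun t => H t * X t * R := by
    filter_upwards [hU.mem_nhds hu] with t ht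
    rw [hX' t ht, mul_assoc]
  have h1 := hX.hasDerivAt u hu
  have h2 : HasDerivAt (fun t => H t * X t) _ u := (hasDerivAt_of_contDiffOn hU hH hu).mul h1
  rw [e1.deriv_eq, e2.deriv_eq]
  refine ⟨?_, ?_⟩
  · rw [(h1.mul_const R).deriv, h1.deriv]
  · rw [(h2.mul_const R).deriv, h2.deriv]

/-- `R` is the conserved quantity `X* H' X'`; multiplying it by `X` on the left and using `X X* =
H'⁻¹` recovers `X'`. -/
theorem exists_eq_mul_right (hX : IsSchwarzFrame σ U H X) {X' : ℝ → A}
    (hX' : IsSchwarzFrame σ U H X')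
    (hσ : ∀ x y, σ (x * y) = σ y * σ x) (hσσ : ∀ x, σ (σ x) = x) (hU : IsOpen U)
    (hU' : U.OrdConnected) (hH : ContDiffOn ℝ ∞ H U) (hHσ : ∀ u ∈ U, σ (H u) = H u)
    (hH1 : ∀ u ∈ U, IsUnit (deriv H u)) :
    ∃ R, (σ R * R = 1 ∧ R * σ R = 1) ∧ ∀ u ∈ U, X' u = X u * R := by
  have hone := map_one_of_anti hσ hσσ
  rcases U.eq_empty_or_nonempty with rfl | ⟨u₀, hu₀⟩
  · exact ⟨1, by simp [hone], by simp⟩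
  have hH1σ : ∀ u ∈ U, σ (deriv H u) = deriv H u := fun u hu => by
    simpa using map_iteratedDeriv hU hH hHσ 1 u hu
  have hder : ∀ u ∈ U, HasDerivAt (fun t => σ (X t) * deriv H t * X' t) 0 u := fun u hu => by
    have e1 : HasDerivAt (deriv H) (iteratedDeriv 2 H u) u := by
      simpa using hasDerivAt_iteratedDeriv hU hH 1 hu
    have h1 := σ.hasFDerivAt.comp_hasDerivAt u (hX.hasDerivAt u hu)
    refine ((h1.mul e1).mul (hX'.hasDerivAt u hu)).congr_deriv ?_
    simp only [Function.comp_apply, map_smul, hσ, map_iteratedDeriv hU hH hHσ 2 u hu,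
      map_ringInverse hσ hσσ (hH1 u hu) (hH1σ u hu), mul_assoc, smul_mul_assoc,
      mul_smul_comm, Ring.inverse_mul_cancel_left _ _ (hH1 u hu),
      Ring.mul_inverse_cancel_left _ _ (hH1 u hu), add_mul, Pi.mul_apply]
    module
  obtain ⟨R, hR⟩ := exists_eq_of_hasDerivAt_zero hU hU' hder
  have hXR : ∀ u ∈ U, X' u = X u * R := fun u hu => by
    rw [← hR u hu, ← mul_assoc, ← mul_assoc, hX.mul_star u hu,
      Ring.inverse_mul_cancel _ (hH1 u hu), one_mul]
  have hXu := hX.isUnit u₀ hu₀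
  have hσXu : IsUnit (σ (X u₀)) := by
    obtain ⟨v, hv⟩ := hXu
    refine ⟨⟨σ v, σ ↑v⁻¹, ?_, ?_⟩, by rw [← hv]⟩ <;> rw [← hσ] <;> simp [hone]
  have hRR : R * σ R = 1 := by
    have h := hX'.mul_star u₀ hu₀
    rw [hXR u₀ hu₀, hσ, ← hX.mul_star u₀ hu₀, mul_assoc] at h
    have h' := hXu.mul_left_cancel h
    rw [← mul_assoc] at h'
    exact hσXu.mul_right_cancel (h'.trans (one_mul _).symm)
  -- A right inverse is not enough for orthogonality; `R` is a quotient of units, so `σ R` is also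
  -- its left inverse.
  have hRu : IsUnit R := by
    have h : R = Ring.inverse (X u₀) * X' u₀ := by
      rw [hXR u₀ hu₀, Ring.inverse_mul_cancel_left _ _ hXu]
    rw [h]
    exact hXu.ringInverse.mul (hX'.isUnit u₀ hu₀)
  refine ⟨R, ⟨hRu.mul_left_cancel ?_, hRR⟩, hXR⟩
  rw [← mul_assoc, hRR, one_mul, mul_one]

/-- The columns of a solution of `N' = N [[0, 1], [C, 0]]` come from a frame. -/
theorem of_hasDerivAt (hU : IsOpen U) (hH : ContDiffOn ℝ ∞ H U)
    (hσ : ∀ x y, σ (x * y) = σ y * σ x) (hHσ : ∀ u ∈ U, σ (H u) = H u)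
    (hH1 : ∀ u ∈ U, IsUnit (deriv H u)) {a b c d C : ℝ → A}
    (ha : ∀ u ∈ U, HasDerivAt a (b u * C u) u) (hb : ∀ u ∈ U, HasDerivAt b (a u) u)
    (hc : ∀ u ∈ U, HasDerivAt c (d u * C u) u) (hd : ∀ u ∈ U, HasDerivAt d (c u) u)
    (hbd : ∀ u ∈ U, b u = H u * d u) (hdu : ∀ u ∈ U, IsUnit (d u))
    (hsymp : ∀ u ∈ U, σ (d u) * a u - σ (b u) * c u = 1) :
    IsSchwarzFrame σ U H d ∧
      ∀ u ∈ U, a u = deriv (fun t => H t * d t) u ∧ c u = deriv d u := by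
  have hev : ∀ u ∈ U, b =ᶠ[𝓝 u] fun t => H t * d t := fun u hu => by
    filter_upwards [hU.mem_nhds hu] with t ht using hbd t ht
  have hprod : ∀ u ∈ U, HasDerivAt (fun t => H t * d t) (deriv H u * d u + H u * c u) u :=
    fun u hu => (hasDerivAt_of_contDiffOn hU hH hu).mul (hd u hu)
  have ha' : ∀ u ∈ U, a u = deriv H u * d u + H u * c u := fun u hu =>
    (hb u hu).unique ((hprod u hu).congr_of_eventuallyEq (hev u hu))
  have hc' : ∀ u ∈ U,
      c u = -(1 / 2 : ℝ) • (Ring.inverse (deriv H u) * iteratedDeriv 2 H u * d u) := by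
    intro u hu
    have e0 := hasDerivAt_of_contDiffOn hU hH hu
    have e1 : HasDerivAt (deriv H) (iteratedDeriv 2 H u) u := by
      simpa using hasDerivAt_iteratedDeriv hU hH 1 hu
    have heq : a =ᶠ[𝓝 u] fun t => deriv H t * d t + H t * c t := by
      filter_upwards [hU.mem_nhds hu] with t ht using ha' t ht
    -- Two expressions for `a'`: the common term `H d C` cancels and leaves `H'' d + 2 H' c = 0`.
    have h := (ha u hu).unique
      (((e1.mul (hd u hu)).add (e0.mul (hc u hu))).congr_of_eventuallyEq heq)
    rw [hbd u hu, mul_assoc] at h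
    have h2 : iteratedDeriv 2 H u * d u = -(2 : ℝ) • (deriv H u * c u) := by
      have h3 : iteratedDeriv 2 H u * d u + (2 : ℝ) • (deriv H u * c u) = 0 := by
        rw [← add_right_cancel_iff (a := H u * (d u * C u)), zero_add]
        nth_rw 2 [h]
        module
      rw [neg_smul]
      exact eq_neg_of_add_eq_zero_left h3
    rw [mul_assoc, h2, mul_smul_comm, Ring.inverse_mul_cancel_left _ _ (hH1 u hu), smul_smul]
    norm_num
  refine ⟨⟨hdu, fun u hu => ?_, fun u hu => ?_⟩, fun u hu => ⟨?_, (hd u hu).deriv.symm⟩⟩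
  · rw [← hc' u hu]
    exact hd u hu
  · refine mul_star_eq_of_star_mul_mul_eq_one (hdu u hu) (hH1 u hu) ?_
    have h := hsymp u hu
    rwa [ha' u hu, hbd u hu, hσ, hHσ u hu, mul_add, mul_assoc, add_sub_cancel_right,
      ← mul_assoc] at h
  · rw [ha' u hu, (hprod u hu).deriv]

end IsSchwarzFrame

end Schwarzian

section Graph

/-! ### Curves of graphs -/

section Curves

/-- Here `Q` projects onto the graph of `H`. With `G` fixed, `q Q(t) G` is the identity at `t = u`,
hence invertible nearby, where `H = (p Q G) (q Q G)⁻¹` is smooth. -/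
theorem contDiffOn_of_comp_projection {E F : Type*} [NormedAddCommGroup E] [NormedSpace ℝ E]
    [CompleteSpace E] [NormedAddCommGroup F] [NormedSpace ℝ F] (p q : F →L[ℝ] E) {U : Set ℝ}
    {H : ℝ → E →L[ℝ] E} {Q : ℝ → F →L[ℝ] F} (hU : IsOpen U) (hQ : ContDiffOn ℝ ∞ Q U)
    (hpq : ∀ u ∈ U, ∀ x, p (Q u x) = H u (q (Q u x)))
    (hG : ∀ u ∈ U, ∃ G : E →L[ℝ] F, ∀ k, q (Q u (G k)) = k) : ContDiffOn ℝ ∞ H U := by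
  intro u hu
  obtain ⟨G, hG⟩ := hG u hu
  have hcomp : ∀ r : F →L[ℝ] E, ContDiffAt ℝ ∞ (fun t => r ∘L Q t ∘L G) u := fun r =>
    ((ContinuousLinearMap.compL ℝ E F E r) ∘L
      ((ContinuousLinearMap.compL ℝ E F F).flip G)).contDiff.contDiffAt.comp u
        (hQ.contDiffAt (hU.mem_nhds hu))
  set v : ℝ → E →L[ℝ] E := fun t => q ∘L Q t ∘L G with hv
  have hvu : v u = ((1 : (E →L[ℝ] E)ˣ) : E →L[ℝ] E) := by
    ext k
    exact hG k
  have hvc : ContDiffAt ℝ ∞ v u := hcomp q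
  have hinv : ContDiffAt ℝ ∞ (fun t => Ring.inverse (v t)) u := by
    have h := contDiffAt_ringInverse ℝ (n := ∞) (1 : (E →L[ℝ] E)ˣ)
    rw [← hvu] at h
    exact h.comp u hvc
  have hunit : ∀ᶠ t in 𝓝 u, IsUnit (v t) := by
    refine hvc.continuousAt.eventually (Units.isOpen.mem_nhds ?_)
    change IsUnit (v u)
    rw [hvu]
    exact Units.isUnit _
  refine (((hcomp p).clm_comp hinv).congr_of_eventuallyEq ?_).contDiffWithinAt
  filter_upwards [hU.mem_nhds hu, hunit] with t ht htu
  have h1 : p ∘L Q t ∘L G = H t * v t := by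
    ext k
    exact hpq t ht (G k)
  rw [h1]
  change H t = H t * v t * Ring.inverse (v t)
  rw [Ring.mul_inverse_cancel_right _ _ htu]

theorem tendsto_smul_of_isLittleO {B : Type*} [NormedAddCommGroup B] [NormedSpace ℝ B]
    {R : ℝ → B} {L : B}
    (h : (fun h : ℝ => R h - (2 * h⁻¹) • L) =o[𝓝[≠] 0] fun h : ℝ => h⁻¹) :
    Filter.Tendsto (fun h => h • ((1 / 2 : ℝ) • R h)) (𝓝[≠] 0) (𝓝 L) := by
  have h1 := (Asymptotics.isBigO_refl (fun h : ℝ => h) (𝓝[≠] 0)).smul_isLittleO h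
  have h2 : Filter.Tendsto (fun h : ℝ => h • (R h - (2 * h⁻¹) • L)) (𝓝[≠] 0) (𝓝 0) := by
    rw [← Asymptotics.isLittleO_one_iff ℝ]
    refine h1.congr' Filter.EventuallyEq.rfl ?_
    filter_upwards [self_mem_nhdsWithin] with t ht
    exact mul_inv_cancel₀ ht
  have h3 := (h2.const_smul (1 / 2 : ℝ)).add_const L
  rw [smul_zero, zero_add] at h3
  refine h3.congr' ?_
  filter_upwards [self_mem_nhdsWithin] with t ht
  have ht' : t ≠ 0 := ht
  rw [smul_sub, smul_sub, smul_smul, smul_smul, smul_smul, smul_smul,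
    show 1 / 2 * t * (2 * t⁻¹) = (1 : ℝ) by field_simp, one_smul, sub_add_cancel,
    mul_comm t]

/-- Difference quotients times `h D h` equal `1` on either side; the limit gives an inverse of the
derivative itself, not just of the differences. -/
theorem deriv_mul_eq_one_of_tendsto {A : Type*} [NormedRing A] [NormedAlgebra ℝ A] {H : ℝ → A}
    {H' Λ : A} {u : ℝ} (hH : HasDerivAt H H' u) {D : ℝ → A}
    (hD : Filter.Tendsto (fun h => h • D h) (𝓝[≠] 0) (𝓝 Λ))
    (h1 : ∀ᶠ h in 𝓝[≠] 0, (H (u + h) - H u) * D h = 1)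
    (h2 : ∀ᶠ h in 𝓝[≠] 0, D h * (H (u + h) - H u) = 1) : H' * Λ = 1 ∧ Λ * H' = 1 := by
  have hs := hH.tendsto_slope_zero
  constructor
  · refine tendsto_nhds_unique ((hs.mul hD).congr' ?_) tendsto_const_nhds
    filter_upwards [h1, self_mem_nhdsWithin] with t ht ht0
    rw [smul_mul_smul_comm, inv_mul_cancel₀ ht0, one_smul, ht]
  · refine tendsto_nhds_unique ((hD.mul hs).congr' ?_) tendsto_const_nhds
    filter_upwards [h2, self_mem_nhdsWithin] with t ht ht0
    rw [smul_mul_smul_comm, mul_inv_cancel₀ ht0, one_smul, ht]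

end Curves

/-! ### Graphs over `K₋` and the reflections between them. -/

theorem reflection_add {T : Type*} [NormedAddCommGroup T] [InnerProductSpace ℝ T]
    {A B : Submodule ℝ T} (h : A.IsTopCompl B) {a b : T} (ha : a ∈ A)
    (hb : b ∈ B) : reflection A B (a + b) = a - b := by
  have h1 : A.projectionL B h a = a := A.projectionL_apply_left h ⟨a, ha⟩
  have h2 : A.projectionL B h b = 0 := A.projectionL_apply_right h ⟨b, hb⟩
  have h3 : B.projectionL A h.symm a = 0 := B.projectionL_apply_right h.symm ⟨a, ha⟩
  have h4 : B.projectionL A h.symm b = b := B.projectionL_apply_left h.symm ⟨b, hb⟩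
  rw [reflection, dif_pos h, sub_apply, map_add, map_add, h1, h2, h3, h4, add_zero, zero_add]

variable {T : Type*} [NormedAddCommGroup T] [InnerProductSpace ℝ T] [CompleteSpace T]

namespace HyperbolicStructure

variable {S : SymplecticStructure T} (P : HyperbolicStructure S)

/-- The projection onto `L` along `K₊` kills `K₊` and does not change the `K₋` component, so a point
of `L` is determined by that component. -/
theorem exists_eq_graph {L : Submodule ℝ T} (h : L.IsTopCompl P.plus) :
    ∃ H : P.plus →L[ℝ] P.plus, L = P.graph H := by
  refine ⟨P.fst ∘L L.projectionL P.plus h ∘L P.J ∘L P.plus.subtypeL, ?_⟩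
  ext x
  have h1 : L.projectionL P.plus h (P.J (P.snd x)) = L.projectionL P.plus h x := by
    conv_rhs => rw [← P.fst_add_J_snd x, map_add, L.projectionL_apply_right h, zero_add]
  have h2 : P.snd (L.projectionL P.plus h x) = P.snd x := by
    conv_rhs => rw [← L.projectionL_add_projectionL_eq_self h x, map_add,
      P.mem_plus_iff_snd.1 (P.plus.projectionL_apply_mem h.symm x), add_zero]
  rw [mem_graph]
  change x ∈ L ↔ P.fst x = P.fst (L.projectionL P.plus h (P.J (P.snd x)))
  rw [h1, ← L.projectionL_eq_self_iff h]
  exact ⟨fun hx => by rw [hx], fun hx => P.ext_fst_snd hx.symm h2⟩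

theorem graph_mem (H : P.plus →L[ℝ] P.plus) (k : P.plus) : (H k : T) + P.J k ∈ P.graph H :=
  ⟨k, rfl⟩

theorem adj_eq_of_isIsotropic_graph {H : P.plus →L[ℝ] P.plus} (h : S.IsIsotropic (P.graph H)) :
    P.adj H = H := by
  refine (P.eq_adj _ _ fun k l => ?_).symm
  have := h _ (P.graph_mem H k) _ (P.graph_mem H l)
  rw [P.form_split_symm] at this
  linarith

/-- A curve of graphs is smooth if the reflections `[H(u) H(u)ᗮ]` are. -/
theorem contDiffOn_of_graph {U : Set ℝ} (hU : IsOpen U) {H : ℝ → P.plus →L[ℝ] P.plus}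
    {HH : ℝ → Submodule ℝ T} (hHH : ∀ u ∈ U, HH u = P.graph (H u))
    (hclosed : ∀ u ∈ U, IsClosed (HH u : Set T))
    (hsmooth : ContDiffOn ℝ ∞ (fun u => reflection (HH u) (HH u)ᗮ) U) : ContDiffOn ℝ ∞ H U := by
  have hproj : ∀ u ∈ U, ∀ x ∈ HH u, ∀ y ∈ (HH u)ᗮ,
      ((1 / 2 : ℝ) • (reflection (HH u) (HH u)ᗮ + ContinuousLinearMap.id ℝ T)) (x + y) = x := by
    intro u hu x hx y hy
    have : CompleteSpace (HH u) := (hclosed u hu).completeSpace_coe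
    rw [smul_apply, add_apply, reflection_add (HH u).isTopCompl_orthogonal hx hy,
      ContinuousLinearMap.id_apply]
    module
  have hdecomp : ∀ u ∈ U, ∀ z, ∃ x ∈ HH u, ∃ y ∈ (HH u)ᗮ, z = x + y := by
    intro u hu z
    have : CompleteSpace (HH u) := (hclosed u hu).completeSpace_coe
    exact (HH u).exists_add_mem_mem_orthogonal z
  refine contDiffOn_of_comp_projection P.fst P.snd
    (Q := fun u => (1 / 2 : ℝ) • (reflection (HH u) (HH u)ᗮ + ContinuousLinearMap.id ℝ T))
    hU ((hsmooth.add contDiffOn_const).const_smul _) (fun u hu z => ?_) fun u hu => ?_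
  · obtain ⟨x, hx, y, hy, rfl⟩ := hdecomp u hu z
    rw [hproj u hu x hx y hy]
    rw [hHH u hu, mem_graph] at hx
    exact hx
  · refine ⟨(P.plus.subtypeL ∘L H u) + P.J ∘L P.plus.subtypeL, fun k => ?_⟩
    have h := hproj u hu _ (by rw [hHH u hu]; exact P.graph_mem (H u) k) 0 (Submodule.zero_mem _)
    rw [add_zero] at h
    exact (congrArg P.snd h).trans (P.snd_split_symm _ _)

/-- If `[graph A, graph B] = 2 Q - 1`, then the lower left corner of `Q` is `(A - B)⁻¹`. -/
theorem sub_mul_eq_one_of_isTopCompl {A B : P.plus →L[ℝ] P.plus}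
    (h : (P.graph A).IsTopCompl (P.graph B)) :
    (A - B) * (P.snd ∘L ((1 / 2 : ℝ) • (reflection (P.graph A) (P.graph B) +
      ContinuousLinearMap.id ℝ T)) ∘L P.plus.subtypeL) = 1 ∧
    (P.snd ∘L ((1 / 2 : ℝ) • (reflection (P.graph A) (P.graph B) +
      ContinuousLinearMap.id ℝ T)) ∘L P.plus.subtypeL) * (A - B) = 1 := by
  have hproj : ∀ x ∈ P.graph A, ∀ y ∈ P.graph B,
      ((1 / 2 : ℝ) • (reflection (P.graph A) (P.graph B) + ContinuousLinearMap.id ℝ T)) (x + y)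
        = x := by
    intro x hx y hy
    rw [smul_apply, add_apply, reflection_add h hx hy, ContinuousLinearMap.id_apply]
    module
  constructor
  · ext1 k
    -- Decompose `k ∈ K₊` along the two graphs: the `K₋` components must be opposite, so `k = (A -
    -- B) (P.snd x)`.
    obtain ⟨x, hx, y, hy, hxy⟩ := Submodule.mem_sup.1
      (h.isCompl.codisjoint.eq_top ▸ Submodule.mem_top : (k : T) ∈ P.graph A ⊔ P.graph B)
    have h1 := hproj x hx y hy
    have h2 : P.fst x + P.fst y = k := by rw [← map_add, hxy, fst_coe]
    have h3 : P.snd x + P.snd y = 0 := by rw [← map_add, hxy, snd_coe]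
    rw [hxy] at h1
    rw [mem_graph] at hx hy
    rw [hx, hy, eq_neg_of_add_eq_zero_right h3, map_neg] at h2
    change (A - B) (P.snd (((1 / 2 : ℝ) • (reflection (P.graph A) (P.graph B) +
      ContinuousLinearMap.id ℝ T)) (k : T))) = k
    rw [h1, sub_apply, sub_eq_add_neg, h2]
  · ext1 k
    have h1 := hproj _ (P.graph_mem A k) _ (P.graph_mem B (-k))
    have h2 : (A k : T) + P.J k + ((B (-k) : T) + P.J (-k : P.plus)) = ((A - B) k : P.plus) := by
      rw [sub_apply, map_neg, Submodule.coe_sub, Submodule.coe_neg, Submodule.coe_neg, map_neg]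
      abel
    rw [h2] at h1
    exact (congrArg P.snd h1).trans (P.snd_split_symm _ _)

/-- The derivative of a curve of graphs is inverse to a corner of the tangent covector. -/
theorem deriv_mul_snd_eq_one {U : Set ℝ} (hU : IsOpen U) {H : ℝ → P.plus →L[ℝ] P.plus}
    {HH : ℝ → Submodule ℝ T} (hHH : ∀ u ∈ U, HH u = P.graph (H u))
    (hcompl : ∀ s ∈ U, ∀ t ∈ U, s ≠ t → (HH s).IsTopCompl (HH t))
    {u : ℝ} (hu : u ∈ U) {H' : P.plus →L[ℝ] P.plus} (hH : HasDerivAt H H' u) {L : T →L[ℝ] T}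
    (hL : HasTangentCovector HH u L) :
    H' * (P.snd ∘L L ∘L P.plus.subtypeL) = 1 ∧ (P.snd ∘L L ∘L P.plus.subtypeL) * H' = 1 := by
  -- Replacing reflections by projections costs `h / 2` times the identity, which vanishes in the
  -- limit.
  have h0 : Filter.Tendsto (fun h : ℝ => h • ((1 / 2 : ℝ) • (reflection (HH (u + h)) (HH u) +
      ContinuousLinearMap.id ℝ T))) (𝓝[≠] 0) (𝓝 L) := by
    have h1 := tendsto_smul_of_isLittleO hL
    have h2 : Filter.Tendsto (fun h : ℝ => h • ((1 / 2 : ℝ) • ContinuousLinearMap.id ℝ T))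
        (𝓝[≠] 0) (𝓝 0) := by
      have : Continuous fun h : ℝ => h • ((1 / 2 : ℝ) • ContinuousLinearMap.id ℝ T) := by fun_prop
      simpa using (this.tendsto 0).mono_left nhdsWithin_le_nhds
    simpa only [smul_add, add_zero] using h1.add h2
  have hev : ∀ᶠ h in 𝓝[≠] (0 : ℝ), u + h ∈ U ∧ h ≠ 0 := by
    have h1 : Filter.Tendsto (fun h : ℝ => u + h) (𝓝[≠] 0) (𝓝 u) := by
      have : Continuous fun h : ℝ => u + h := by fun_prop
      simpa using (this.tendsto 0).mono_left nhdsWithin_le_nhds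
    exact (h1.eventually (hU.mem_nhds hu)).and self_mem_nhdsWithin
  have key : ∀ᶠ h in 𝓝[≠] (0 : ℝ),
      (H (u + h) - H u) * (P.snd ∘L ((1 / 2 : ℝ) • (reflection (HH (u + h)) (HH u) +
        ContinuousLinearMap.id ℝ T)) ∘L P.plus.subtypeL) = 1 ∧
      (P.snd ∘L ((1 / 2 : ℝ) • (reflection (HH (u + h)) (HH u) +
        ContinuousLinearMap.id ℝ T)) ∘L P.plus.subtypeL) * (H (u + h) - H u) = 1 := by
    filter_upwards [hev] with h hh
    have hc := hcompl (u + h) hh.1 u hu (by simpa using hh.2)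
    rw [hHH _ hh.1, hHH u hu] at hc ⊢
    exact P.sub_mul_eq_one_of_isTopCompl hc
  refine deriv_mul_eq_one_of_tendsto hH (D := fun h => P.snd ∘L ((1 / 2 : ℝ) •
    (reflection (HH (u + h)) (HH u) + ContinuousLinearMap.id ℝ T)) ∘L P.plus.subtypeL) ?_
    (key.mono fun _ h => h.1) (key.mono fun _ h => h.2)
  have hcont : Continuous fun F : T →L[ℝ] T => P.snd ∘L F ∘L P.plus.subtypeL :=
    ((ContinuousLinearMap.compL ℝ P.plus T P.plus P.snd) ∘L
      ((ContinuousLinearMap.compL ℝ P.plus T T).flip P.plus.subtypeL)).continuous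
  refine ((hcont.tendsto L).comp h0).congr fun h => ?_
  ext1 k
  exact map_smul P.snd h _

/-- A symmetric operator with positive semidefinite inverse is positive definite. -/
theorem g_pos_of_mul_eq_one {X Y : P.plus →L[ℝ] P.plus} (hXY : X * Y = 1) (hYX : Y * X = 1)
    (hX : P.adj X = X) (hY : ∀ k : P.plus, 0 ≤ P.g (Y k) k) {k : P.plus} (hk : k ≠ 0) :
    0 < P.g (X k) k := by
  have e1 : ∀ k, X (Y k) = k := fun k => congrArg (fun F : P.plus →L[ℝ] P.plus => F k) hXY
  have e2 : ∀ k, Y (X k) = k := fun k => congrArg (fun F : P.plus →L[ℝ] P.plus => F k) hYX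
  -- Cauchy–Schwarz for `g(Y ·, ·)` at `X k` and `k` reads `g(k, k)² ≤ g(X k, k) g(Y k, k)`.
  have hcs := LinearMap.BilinForm.apply_mul_apply_le_of_forall_zero_le
    (LinearMap.mk₂ ℝ (fun k l : P.plus => P.g (Y k) l)
      (fun x y z => by rw [map_add, Submodule.coe_add, g_add_left])
      (fun c x y => by rw [map_smul, Submodule.coe_smul, g_smul_left, smul_eq_mul])
      (fun x y z => by rw [Submodule.coe_add, g_add_right])
      (fun c x y => by rw [Submodule.coe_smul, g_smul_right, smul_eq_mul])) hY (X k) k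
  simp only [LinearMap.mk₂_apply, e2] at hcs
  have h1 : P.g (Y k) (X k) = P.g k k := by
    conv_lhs => rw [← hX, ← g_adj, e1]
  rw [h1, P.g_comm k (X k)] at hcs
  have h2 := P.g_self_pos (x := (k : T)) (by simpa using hk)
  by_contra hle
  push Not at hle
  nlinarith [hY k, mul_nonneg (neg_nonneg.2 hle) (hY k), mul_pos h2 h2]

end HyperbolicStructure

end Graph

section Lifts

/-! ### Lifts to the symplectic group. -/

theorem maurerCartan_eq_iff {T : Type*} [NormedAddCommGroup T] [InnerProductSpace ℝ T]
    {M : ℝ → T →L[ℝ] T} {u : ℝ} (hM : IsUnit (M u)) (Θ : T →L[ℝ] T) :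
    maurerCartan M u = Θ ↔ deriv M u = M u * Θ := by
  rw [maurerCartan]
  constructor
  · rintro rfl
    rw [Ring.mul_inverse_cancel_left _ _ hM]
  · intro h
    rw [h, Ring.inverse_mul_cancel_left _ _ hM]

/-- Reads one block entry of `N' = N Θ`: `Θ` sends the column `i` to the column `j` through `C`. -/
theorem hasDerivAt_comp_comp {E F : Type*} [NormedAddCommGroup E] [NormedSpace ℝ E]
    [NormedAddCommGroup F] [NormedSpace ℝ F] (p : F →L[ℝ] E) (i j : E →L[ℝ] F)
    {N : ℝ → F →L[ℝ] F} {Θ : F →L[ℝ] F} {C : E →L[ℝ] E} {u : ℝ}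
    (hN : HasDerivAt N (N u * Θ) u) (hΘ : ∀ k, Θ (i k) = j (C k)) :
    HasDerivAt (fun t => p ∘L N t ∘L i) ((p ∘L N u ∘L j) * C) u := by
  have h := ((ContinuousLinearMap.compL ℝ E F E p) ∘L
    ((ContinuousLinearMap.compL ℝ E F F).flip i)).hasFDerivAt.comp_hasDerivAt u hN
  refine h.congr_deriv (ContinuousLinearMap.ext fun k => ?_)
  exact congrArg (fun x => p (N u x)) (hΘ k)

theorem IsSchwarzFrame.contDiffOn_mul {A : Type*} [NormedRing A] [NormedAlgebra ℝ A]
    [CompleteSpace A] {σ : A →L[ℝ] A} {U : Set ℝ} {H X : ℝ → A} (hX : IsSchwarzFrame σ U H X)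
    (hU : IsOpen U) (hH : ContDiffOn ℝ ∞ H U) (hH1 : ∀ u ∈ U, IsUnit (deriv H u)) :
    ContDiffOn ℝ ∞ (fun t => H t * X t) U :=
  hH.mul (hX.contDiffOn hU hH hH1)

theorem contDiffOn_deriv {E : Type*} [NormedAddCommGroup E] [NormedSpace ℝ E] {U : Set ℝ}
    {f : ℝ → E} (hU : IsOpen U) (hf : ContDiffOn ℝ ∞ f U) : ContDiffOn ℝ ∞ (deriv f) U :=
  ((contDiffOn_infty_iff_deriv_of_isOpen hU).1 hf).2

variable {T : Type*} [NormedAddCommGroup T] [InnerProductSpace ℝ T] [CompleteSpace T]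

namespace HyperbolicStructure

variable {S : SymplecticStructure T} (P : HyperbolicStructure S)

/-! ### Frames and lifts -/

theorem isFrame_iff {σ : (P.plus →L[ℝ] P.plus) →L[ℝ] (P.plus →L[ℝ] P.plus)}
    (hσ : ∀ X, σ X = P.adj X) {U : Set ℝ} {H X : ℝ → P.plus →L[ℝ] P.plus} :
    P.IsFrame U H X ↔ IsSchwarzFrame σ U H X :=
  ⟨fun h => ⟨h.isUnit, h.hasDerivAt, fun u hu => by rw [hσ]; exact h.mul_adj u hu⟩,
    fun h => ⟨h.isUnit, h.hasDerivAt, fun u hu => by rw [← hσ]; exact h.mul_star u hu⟩⟩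

theorem schwarzian_eq {σ : (P.plus →L[ℝ] P.plus) →L[ℝ] (P.plus →L[ℝ] P.plus)}
    (hσ : ∀ X, σ X = P.adj X) (H X : ℝ → P.plus →L[ℝ] P.plus) (u : ℝ) :
    P.schwarzian H X u = algSchwarzian σ H X u := by
  rw [schwarzian, ← hσ]
  rfl

/-- The matrix factors as `[[1, w], [0, 1]] [[u, 0], [C, v]]`, and the inverse is the product of the
inverted factors. -/
theorem isUnit_block_of_eq {A B C D : P.plus →L[ℝ] P.plus} {u v w : P.plus →L[ℝ] P.plus}
    (hu : IsUnit u) (hv : IsUnit v) (hA : A = u + w * C) (hB : B = w * v) (hD : D = v) :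
    IsUnit (P.block A B C D) := by
  obtain ⟨u, rfl⟩ := hu
  obtain ⟨v, rfl⟩ := hv
  subst hA hB hD
  have h1 : ∀ x y : P.plus →L[ℝ] P.plus, x * y = 1 → ∀ k, x (y k) = k := fun x y h k =>
    congrArg (fun F : P.plus →L[ℝ] P.plus => F k) h
  have hu1 := h1 _ _ u.mul_inv
  have hu2 := h1 _ _ u.inv_mul
  have hv1 := h1 _ _ v.mul_inv
  have hv2 := h1 _ _ v.inv_mul
  refine ⟨⟨P.block (u + w * C) (w * v) C v,
    P.block (↑u⁻¹) (-(↑u⁻¹ * w)) (-(↑v⁻¹ * C * ↑u⁻¹)) (↑v⁻¹ + ↑v⁻¹ * C * ↑u⁻¹ * w), ?_, ?_⟩, rfl⟩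
  · ext1 x
    apply P.ext_fst_snd <;> (simp [hu1, hv1]; abel)
  · ext1 x
    apply P.ext_fst_snd
    · simp [hu2]
    · simp [hu2, hv2]
      abel

section Lift

variable {σ : (P.plus →L[ℝ] P.plus) →L[ℝ] (P.plus →L[ℝ] P.plus)} {U : Set ℝ}
  {H X : ℝ → P.plus →L[ℝ] P.plus}

theorem isUnit_lift (hX : IsSchwarzFrame σ U H X) (hU : IsOpen U)
    (hH : ContDiffOn ℝ ∞ H U)
    (hH1 : ∀ u ∈ U, IsUnit (deriv H u)) {u : ℝ} (hu : u ∈ U) : IsUnit (P.lift H X u) :=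
  P.isUnit_block_of_eq ((hH1 u hu).mul (hX.isUnit u hu)) (hX.isUnit u hu)
    (hX.deriv_mul_eq hU hH hu) rfl rfl

theorem isLift_lift (hX : IsSchwarzFrame σ U H X) (hσ : ∀ X, σ X = P.adj X) (hU : IsOpen U)
    (hH : ContDiffOn ℝ ∞ H U) (hHσ : ∀ u ∈ U, P.adj (H u) = H u)
    (hH1 : ∀ u ∈ U, IsUnit (deriv H u)) {HH : ℝ → Submodule ℝ T}
    (hHH : ∀ u ∈ U, HH u = P.graph (H u)) : S.IsLift U HH P.minus (P.lift H X) where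
  smooth := P.contDiffOn_block (contDiffOn_deriv hU (hX.contDiffOn_mul hU hH hH1))
    (hX.contDiffOn_mul hU hH hH1) (contDiffOn_deriv hU (hX.contDiffOn hU hH hH1))
    (hX.contDiffOn hU hH hH1)
  canonical u hu := by
    have h := hX.symplectic_relations (fun x y => by rw [hσ, hσ, hσ, adj_mul])
      (fun x => by rw [hσ, hσ, adj_adj]) hU hH (fun u hu => by rw [hσ, hHσ u hu]) hH1 hu
    simp only [hσ] at h
    exact P.isCanonical_block (P.isUnit_lift hX hU hH hH1 hu) h.1 h.2.1 h.2.2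
  lagrangian := P.isLagrangian_minus
  comap_eq u hu := by
    ext x
    rw [Submodule.mem_comap, hHH u hu, mem_minus_iff_fst]
    change P.lift H X u x ∈ P.graph (H u) ↔ _
    have h1 : ∀ k, deriv (fun t => H t * X t) u k = (deriv H u * X u) k + H u (deriv X u k) :=
      fun k => congrArg (fun F : P.plus →L[ℝ] P.plus => F k) (hX.deriv_mul_eq hU hH hu)
    -- The defect of `M x` from lying on the graph is `H' X` applied to the `K₊` component of `x`.
    have h2 : Function.Injective (deriv H u * X u) :=
      (ContinuousLinearMap.isUnit_iff_bijective.1 ((hH1 u hu).mul (hX.isUnit u hu))).1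
    rw [mem_graph, lift, fst_block, snd_block, h1, map_add, add_assoc]
    change (deriv H u * X u) (P.fst x) + _ = _ ↔ _
    rw [mul_apply_eq_comp (H u), add_eq_right]
    exact ⟨fun h => h2 (h.trans (map_zero _).symm), fun h => by rw [h, map_zero]⟩

theorem hasDerivAt_lift (hX : IsSchwarzFrame σ U H X) (hU : IsOpen U)
    (hH : ContDiffOn ℝ ∞ H U)
    (hH1 : ∀ u ∈ U, IsUnit (deriv H u)) {u : ℝ} (hu : u ∈ U) :
    HasDerivAt (P.lift H X)
      (P.lift H X u * P.block 0 1 (-(1 / 2 : ℝ) • algSchwarzian σ H X u) 0) u := by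
  have hY := hasDerivAt_of_contDiffOn hU (hX.contDiffOn_mul hU hH hH1) hu
  have hX' := hasDerivAt_of_contDiffOn hU (hX.contDiffOn hU hH hH1) hu
  refine (P.hasDerivAt_block (hX.hasDerivAt_deriv_mul hU hH hH1 hu) hY
    (hX.hasDerivAt_deriv hU hH hH1 hu) hX').congr_deriv ?_
  ext1 x
  apply P.ext_fst_snd <;> simp only [lift, mul_apply_eq_comp, fst_block, snd_block, zero_apply,
    one_apply_eq_self, zero_add, add_comm]

theorem lift_mul_right (hX : IsSchwarzFrame σ U H X) (hU : IsOpen U)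
    (hH : ContDiffOn ℝ ∞ H U)
    {X' : ℝ → P.plus →L[ℝ] P.plus} {R : P.plus →L[ℝ] P.plus} (hX' : ∀ u ∈ U, X' u = X u * R)
    {u : ℝ} (hu : u ∈ U) : P.lift H X' u = P.lift H X u * P.block R 0 0 R := by
  obtain ⟨h1, h2⟩ := hX.deriv_mul_right hU hH hX' hu
  rw [lift, h1, h2, hX' u hu]
  ext1 x
  apply P.ext_fst_snd <;> simp only [lift, mul_apply_eq_comp, fst_block, snd_block, zero_apply,
    zero_add, add_zero]

theorem fst_eq_of_comap_graph_eq {G : P.plus →L[ℝ] P.plus} {N : T →L[ℝ] T}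
    (hN : (P.graph G).comap (N : T →ₗ[ℝ] T) = P.minus) (k : P.plus) :
    P.fst (N (P.J k)) = G (P.snd (N (P.J k))) := by
  have h : P.J k ∈ P.minus := P.mem_minus_iff_fst.2 (P.fst_J k)
  rw [← hN, Submodule.mem_comap] at h
  exact P.mem_graph.1 h

/-- `N` restricts to a bijection of `K₋` onto the graph, and `P.snd` is a bijection of the graph
onto `K₊`. -/
theorem isUnit_snd_comp_J {G : P.plus →L[ℝ] P.plus} {N : T →L[ℝ] T}
    (hN : (P.graph G).comap (N : T →ₗ[ℝ] T) = P.minus) (hbij : Function.Bijective N) :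
    IsUnit (P.snd ∘L N ∘L P.J ∘L P.plus.subtypeL) := by
  rw [ContinuousLinearMap.isUnit_iff_bijective]
  constructor
  · rw [injective_iff_map_eq_zero]
    intro k hk
    have hk' : P.snd (N (P.J k)) = 0 := hk
    have h1 : N (P.J k) = N 0 := by
      rw [map_zero]
      apply P.ext_fst_snd
      · rw [P.fst_eq_of_comap_graph_eq hN, hk', map_zero, map_zero]
      · rw [hk', map_zero]
    have h2 := congrArg P.snd (hbij.1 h1)
    rwa [snd_J, map_zero] at h2
  · intro k
    obtain ⟨x, hx⟩ := hbij.2 ((G k : T) + P.J k)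
    have h1 : x ∈ P.minus := by
      rw [← hN, Submodule.mem_comap]
      change N x ∈ _
      rw [hx]
      exact P.graph_mem G k
    have h2 : P.J (P.snd x) = x := by
      conv_rhs => rw [← P.fst_add_J_snd x, P.mem_minus_iff_fst.1 h1, Submodule.coe_zero, zero_add]
    refine ⟨P.snd x, ?_⟩
    change P.snd (N (P.J (P.snd x))) = k
    rw [h2, hx, snd_split_symm]

/-- A lift whose Maurer–Cartan form has the shape `[[0, 1], [C, 0]]` is the lift of a frame. -/
theorem exists_isSchwarzFrame_of_isLift (hσ : ∀ X, σ X = P.adj X) (hU : IsOpen U)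
    (hH : ContDiffOn ℝ ∞ H U) (hHσ : ∀ u ∈ U, P.adj (H u) = H u)
    (hH1 : ∀ u ∈ U, IsUnit (deriv H u)) {HH : ℝ → Submodule ℝ T}
    (hHH : ∀ u ∈ U, HH u = P.graph (H u)) {N : ℝ → T →L[ℝ] T} (hN : S.IsLift U HH P.minus N)
    (hC : ∀ u ∈ U, ∃ C, maurerCartan N u = P.block 0 1 C 0) :
    ∃ X, IsSchwarzFrame σ U H X ∧ ∀ u ∈ U, N u = P.lift H X u := by
  have hC' : ∀ u, ∃ C, u ∈ U → maurerCartan N u = P.block 0 1 C 0 := fun u => by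
    by_cases hu : u ∈ U
    · obtain ⟨C, hC⟩ := hC u hu
      exact ⟨C, fun _ => hC⟩
    · exact ⟨0, fun h => absurd h hu⟩
  choose C hC using hC'
  have hNu : ∀ u ∈ U, IsUnit (N u) := fun u hu =>
    ContinuousLinearMap.isUnit_iff_bijective.2 (hN.canonical u hu).1
  have hN' : ∀ u ∈ U, HasDerivAt N (N u * P.block 0 1 (C u) 0) u := fun u hu => by
    rw [← (maurerCartan_eq_iff (hNu u hu) _).1 (hC u hu)]
    exact hasDerivAt_of_contDiffOn hU hN.smooth hu
  have hΘ1 : ∀ u, ∀ k : P.plus, P.block 0 1 (C u) 0 (k : T) = P.J (C u k) := fun u k => by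
    apply P.ext_fst_snd <;> simp
  have hΘ2 : ∀ u, ∀ k : P.plus, P.block 0 1 (C u) 0 (P.J k) = k := fun u k => by
    apply P.ext_fst_snd <;> simp
  have hbd : ∀ u ∈ U, ∀ k : P.plus, P.fst (N u (P.J k)) = H u (P.snd (N u (P.J k))) :=
    fun u hu => P.fst_eq_of_comap_graph_eq (by rw [← hHH u hu]; exact hN.comap_eq u hu)
  have hdu : ∀ u ∈ U, IsUnit (P.snd ∘L N u ∘L P.J ∘L P.plus.subtypeL) := fun u hu =>
    P.isUnit_snd_comp_J (by rw [← hHH u hu]; exact hN.comap_eq u hu) (hN.canonical u hu).1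
  have hblock := fun u => P.block_apply_eq (N u)
  have hsymp := fun u (hu : u ∈ U) => P.adj_mul_sub_of_isCanonical
    ((hblock u) ▸ hN.canonical u hu)
  have ha := fun u (hu : u ∈ U) => hasDerivAt_comp_comp P.fst P.plus.subtypeL
    (P.J ∘L P.plus.subtypeL) (C := C u) (hN' u hu) (hΘ1 u)
  have hb := fun u (hu : u ∈ U) => (hasDerivAt_comp_comp P.fst (P.J ∘L P.plus.subtypeL)
    P.plus.subtypeL (C := 1) (hN' u hu) (hΘ2 u)).congr_deriv (mul_one _)
  have hc := fun u (hu : u ∈ U) => hasDerivAt_comp_comp P.snd P.plus.subtypeL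
    (P.J ∘L P.plus.subtypeL) (C := C u) (hN' u hu) (hΘ1 u)
  have hd := fun u (hu : u ∈ U) => (hasDerivAt_comp_comp P.snd (P.J ∘L P.plus.subtypeL)
    P.plus.subtypeL (C := 1) (hN' u hu) (hΘ2 u)).congr_deriv (mul_one _)
  obtain ⟨hframe, hac⟩ := IsSchwarzFrame.of_hasDerivAt (A := P.plus →L[ℝ] P.plus) (σ := σ) hU hH
    (fun x y => by rw [hσ, hσ, hσ, adj_mul]) (fun u hu => by rw [hσ, hHσ u hu]) hH1
    ha hb hc hd (fun u hu => ContinuousLinearMap.ext (hbd u hu)) hdu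
    (fun u hu => by rw [hσ, hσ]; exact hsymp u hu)
  refine ⟨_, hframe, fun u hu => ?_⟩
  rw [lift, ← (hac u hu).1, ← (hac u hu).2]
  refine (hblock u).trans (P.block_inj.2 ⟨rfl, ?_, rfl, rfl⟩)
  exact ContinuousLinearMap.ext (hbd u hu)

end Lift

end HyperbolicStructure

end Lifts

end LagrangeLift

end

/-! ### Proof of the theorem. -/

theorem mainTheorem3 {T : Type*} [NormedAddCommGroup T] [InnerProductSpace ℝ T] [CompleteSpace T]
    (S : LagrangeLift.SymplecticStructure T)
    (U : Set ℝ) (hU : IsOpen U) (hU' : U.OrdConnected)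
    (HH : ℝ → Submodule ℝ T) (hH : S.IsPositiveRegularCurve U HH)
    (P : LagrangeLift.HyperbolicStructure S)
    (hplus : ∀ u ∈ U, (HH u).IsTopCompl P.plus)
    (hminus : ∀ u ∈ U, (HH u).IsTopCompl P.minus) :
    ∃ H : ℝ → P.plus →L[ℝ] P.plus,
      -- the curve is the graph of a smooth curve of symmetric operators with positive derivative
      (∀ u ∈ U, HH u = P.graph (H u)) ∧
      ContDiffOn ℝ ∞ H U ∧
      (∀ u ∈ U, P.adj (H u) = H u) ∧
      (∀ u ∈ U, IsUnit (deriv H u) ∧ ∀ k : P.plus, k ≠ 0 → 0 < P.g (deriv H u k) k) ∧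
      -- the equations for `X` are solvable on all of `U`
      (∃ X, P.IsFrame U H X) ∧
      ∀ X, P.IsFrame U H X →
        -- `M` is a lift to the symplectic group
        S.IsLift U HH P.minus (P.lift H X) ∧
        -- its Maurer–Cartan form, with symmetric `S`
        (∀ u ∈ U, LagrangeLift.maurerCartan (P.lift H X) u =
          P.block 0 1 (-(1 / 2 : ℝ) • P.schwarzian H X u) 0) ∧
        (∀ u ∈ U, P.adj (P.schwarzian H X u) = P.schwarzian H X u) ∧
        -- the freedom is exactly a constant right factor in `O(K₊)`
        (∀ R, P.IsOrthogonal R →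
          P.IsFrame U H (fun u => X u * R) ∧
          ∀ u ∈ U, P.lift H (fun t => X t * R) u = P.lift H X u * P.block R 0 0 R) ∧
        (∀ X', P.IsFrame U H X' → ∃ R, P.IsOrthogonal R ∧
          ∀ u ∈ U, X' u = X u * R ∧ P.lift H X' u = P.lift H X u * P.block R 0 0 R) ∧
        -- the lift is canonical: it is the only one whose Maurer–Cartan form has this shape
        (∀ N : ℝ → T →L[ℝ] T, S.IsLift U HH P.minus N →
          (∀ u ∈ U, ∃ C, LagrangeLift.maurerCartan N u = P.block 0 1 C 0) →
          ∃ R, P.IsOrthogonal R ∧ ∀ u ∈ U, N u = P.lift H X u * P.block R 0 0 R) := by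
  obtain ⟨hreg, hlag, hpos⟩ := hH
  have hgraph : ∀ u, ∃ G : P.plus →L[ℝ] P.plus, u ∈ U → HH u = P.graph G := fun u => by
    by_cases hu : u ∈ U
    · obtain ⟨G, hG⟩ := P.exists_eq_graph (hplus u hu)
      exact ⟨G, fun _ => hG⟩
    · exact ⟨0, fun h => absurd h hu⟩
  choose H hHH using hgraph
  have hH := P.contDiffOn_of_graph hU hHH hreg.isClosed hreg.smooth
  have hHσ : ∀ u ∈ U, P.adj (H u) = H u := fun u hu =>
    P.adj_eq_of_isIsotropic_graph (hHH u hu ▸ (hlag u hu).prop)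
  obtain ⟨σ, hσ⟩ := P.exists_adjL
  have hσ1 : ∀ x y, σ (x * y) = σ y * σ x := fun x y => by rw [hσ, hσ, hσ, P.adj_mul]
  have hσ2 : ∀ x, σ (σ x) = x := fun x => by rw [hσ, hσ, P.adj_adj]
  have hHσ' : ∀ u ∈ U, σ (H u) = H u := fun u hu => by rw [hσ, hHσ u hu]
  have hH1 : ∀ u ∈ U, IsUnit (deriv H u) ∧ ∀ k : P.plus, k ≠ 0 → 0 < P.g (deriv H u k) k := by
    intro u hu
    obtain ⟨L, hL, hLpos⟩ := hpos u hu
    have hder := LagrangeLift.hasDerivAt_of_contDiffOn hU hH hu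
    obtain ⟨h1, h2⟩ := P.deriv_mul_snd_eq_one hU hHH hreg.nondegenerate hu hder hL
    refine ⟨⟨⟨_, _, h1, h2⟩, rfl⟩, fun k hk => P.g_pos_of_mul_eq_one h1 h2 ?_ (fun l => ?_) hk⟩
    · rw [← hσ]
      exact LagrangeLift.map_hasDerivAt_of_map_eq (A := P.plus →L[ℝ] P.plus) hU hHσ' hu hder
    · have h := hLpos l
      rw [P.form_eq, P.fst_coe, P.snd_coe] at h
      simpa [← P.gL_apply] using h
  have hunit : ∀ u ∈ U, IsUnit (deriv H u) := fun u hu => (hH1 u hu).1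
  refine ⟨H, hHH, hH, hHσ, hH1, ?_, fun X hX => ?_⟩
  · obtain ⟨X, hX⟩ := LagrangeLift.exists_isSchwarzFrame (A := P.plus →L[ℝ] P.plus) hσ1 hσ2 hU
      hU' hH hHσ'
      fun u hu a b ha hb hab => P.isUnit_smul_one_add_smul (hunit u hu) (fun k => by
        rcases eq_or_ne k 0 with rfl | hk
        · simp [← P.gL_apply]
        · exact ((hH1 u hu).2 k hk).le) ha hb hab
    exact ⟨X, (P.isFrame_iff hσ).2 hX⟩
  rw [P.isFrame_iff hσ] at hX
  refine ⟨P.isLift_lift hX hσ hU hH hHσ hunit hHH, fun u hu => ?_, fun u hu => ?_,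
    fun R hR => ⟨?_, fun u hu => ?_⟩, fun X' hX' => ?_, fun N hN hC => ?_⟩
  · rw [LagrangeLift.maurerCartan_eq_iff (P.isUnit_lift hX hU hH hunit hu), P.schwarzian_eq hσ]
    exact (P.hasDerivAt_lift hX hU hH hunit hu).deriv
  · rw [P.schwarzian_eq hσ, ← hσ]
    exact LagrangeLift.IsSchwarzFrame.map_algSchwarzian hσ1 hσ2 hU hH hHσ' hunit hu X
  · rw [P.isOrthogonal_iff, ← hσ] at hR
    exact (P.isFrame_iff hσ).2 (hX.mul_right hσ1 hR.1 hR.2)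
  · exact P.lift_mul_right hX hU hH (fun _ _ => rfl) hu
  · obtain ⟨R, hR, hXR⟩ := hX.exists_eq_mul_right ((P.isFrame_iff hσ).1 hX') hσ1 hσ2 hU hU' hH
      hHσ' hunit
    rw [hσ] at hR
    exact ⟨R, (P.isOrthogonal_iff R).2 hR, fun u hu =>
      ⟨hXR u hu, P.lift_mul_right hX hU hH hXR hu⟩⟩
  -- Since `N` is itself the lift of a frame, uniqueness of lifts reduces to that of frames.
  · obtain ⟨Z, hZ, hNZ⟩ := P.exists_isSchwarzFrame_of_isLift hσ hU hH hHσ hunit hHH hN hC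
    obtain ⟨R, hR, hZR⟩ := hX.exists_eq_mul_right hZ hσ1 hσ2 hU hU' hH hHσ' hunit
    rw [hσ] at hR
    exact ⟨R, (P.isOrthogonal_iff R).2 hR, fun u hu =>
      (hNZ u hu).trans (P.lift_mul_right hX hU hH hZR hu)⟩
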